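/- **Setting.** Let $(\mathcal X,\rho)$ be a Polish space, $I=\{1,\dots,N\}$ with $N\ge 1$, let $w_i:\mathcal X\to\mathcal X$ ($i\in I$) be maps, $\{S(t)\}_{t\ge0}$ a (jointly) continuous flow on $\mathcal X$ (so $S(0)=\mathrm{Id}$, $S(s+t)=S(s)\circ S(t)$), and let $p_i:\mathcal X\to[0,1]$ satisfy $\sum_{i\in I}p_i(x)=1$ for all $x$. Let $\lambda>0$, $\tau_0=0$, and let $\Delta\tau_n=\tau_n-\tau_{n-1}$, $n\ge1$, be i.i.d. with density $\lambda e^{-\lambda t}$ on $[0,\infty)$. For $x\in\mathcal X$ put $\Phi_0^x=x$ and, recursively for $n\ge 1$, $\xi_n=S(\Delta\tau_n)(\Phi_{n-1}^x)$, $\Phi_n^x=w_{i_n}(\xi_n)$, where the random index $i_n\in I$ equals $k$ with probability $p_k(\xi_n)$ (given the past and $\Delta\tau_n$, and independently of the later waiting times). Put $\Phi^x(t)=S(t-\tau_n)(\Phi_n^x)$ for $\tau_n\le t<\tau_{n+1}$, $n\ge 0$, and $P_tf(x)=\mathbb E f(\Phi^x(t))$, $P_t(x,B)=P_t\mathbf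 1_B(x)$, $P_t\mu(B)=\int P_t(x,B)\,\mu(dx)$ for probability measures $\mu$. For $\mathbf i=(i_1,\dots,i_n)\in I^n$ let $w_{\mathbf i[0]}(x)=x$ and $w_{\mathbf i[k]}(x)=w_{i_1}\circ\cdots\circ w_{i_k}(x)$ for $1\le k\le n$. For a function $r:\mathcal X\to(0,1]$ let $J_n(x)=\max_{\mathbf i\in I^n}\prod_{j=0}^{n-1}r(w_{\mathbf i[j]}(x))$. **Theorem.** Assume that there are $z\in\mathcal X$, $r:\mathcal X\to(0,1]$, $\omega:[0,\infty)\to[0,\infty)$ and $0\le\alpha<\lambda$ such that * (B1) all $w_i$ and $p_i$ are continuous; * (B2) $r$ is continuous and $\sum_{i\in I}p_i(x)\rho(w_i(x),z)\le r(x)\rho(x,z)$ for all $x\in\mathcal X$; * (B3) $\omega$ is concave and non-decreasing, $\omega(0)=0$, and $\sum_{i\in I}|p_i(x)-p_i(z)|\le\omega(\rho(x,z))$ for all $x\in\mathcal X$; moreover, if $\alpha>0$, then $\omega$ is not identically zero; * (B4) $\rho(S(t)(x),S(t)(y))\le e^{\alpha t}\rho(x,y)$ for all $x,y\in\mathcal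 X$, $t\ge0$; * (B5) there are $M\in\mathbb N$, $\eta>0$ and $\gamma\in(0,1)$ such that $\sum_{n=M}^\infty\omega\!\left(J_n(x)\,\rho(x,z)\,\frac{\lambda^n}{(\lambda-\alpha)^n}\right)\le1-\gamma$ for all $x\in B(z,\eta)$; * (C1) $S(t)(z)=z$ for all $t\ge0$; * (C2) for every $\epsilon>0$ there is $\beta>0$ such that for every $x\in\mathcal X$ there is $t\ge0$ with $P_t(x,B(z,\epsilon))>\beta$. Then $\{P_t\}_{t\ge0}$ is asymptotically stable: there is a unique probability measure $\mu$ on $\mathcal X$ with $P_t\mu=\mu$ for all $t\ge 0$, and $P_t\nu$ converges weakly to $\mu$ as $t\to\infty$ for every probability measure $\nu$ on $\mathcal X$. -/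

import Mathlib

open Set Filter Topology MeasureTheory ProbabilityTheory
open scoped NNReal ENNReal BoundedContinuousFunction

noncomputable section

/-! ### Markov semigroups and asymptotic stability -/

/-- The dual action `μ ↦ P_t μ` of a family of transition functions `P t x = P_t(x, ·)`:
`(P_t μ)(B) = ∫ P_t(x, B) μ(dx)`. -/
def dualSemigroup {X : Type*} [MeasurableSpace X] (P : ℝ≥0 → X → Measure X) (t : ℝ≥0)
    (μ : Measure X) : Measure X :=
  μ.bind (P t)

/-- `μ` is invariant for the semigroup: `P_t μ = μ` for all `t ≥ 0`. -/
def IsInvariantMeasure {X : Type*} [MeasurableSpace X] (P : ℝ≥0 → X → Measure X)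
    (μ : Measure X) : Prop :=
  ∀ t : ℝ≥0, dualSemigroup P t μ = μ

/-- Asymptotic stability: there is a unique invariant probability measure `μ`, and `P_t ν`
converges weakly to `μ` as `t → ∞` for every probability measure `ν`. -/
def AsymptoticallyStable {X : Type*} [TopologicalSpace X] [MeasurableSpace X]
    (P : ℝ≥0 → X → Measure X) : Prop :=
  ∃ μ : Measure X, IsProbabilityMeasure μ ∧ IsInvariantMeasure P μ ∧
    (∀ ν : Measure X, IsProbabilityMeasure ν → IsInvariantMeasure P ν → ν = μ) ∧
    ∀ ν : Measure X, IsProbabilityMeasure ν → ∀ f : X →ᵇ ℝ,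
      Tendsto (fun t : ℝ≥0 => ∫ x, f x ∂(dualSemigroup P t ν)) atTop (𝓝 (∫ x, f x ∂μ))

/-! ### The random noise and the random choice of an index -/

/-- Sample points: for each step `n` the pair `(Δτ_{n+1}, u_{n+1})` of a waiting time and of the
number used to choose the random index. -/
abbrev Noise : Type := ℕ → ℝ × ℝ

/-- The law of the noise: all the waiting times are exponential with density `lam * exp (-lam t)`,
all the numbers `u` are uniform on `[0, 1]`, and everything is independent. -/
def noiseLaw (lam : ℝ) : Measure Noise :=
  Measure.infinitePi fun _ : ℕ =>
    (expMeasure lam).prod ((volume : Measure ℝ).restrict (Icc (0 : ℝ) 1))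

open Classical in
/-- The index chosen by the number `u` according to the probability vector `q`: the least `k`
with `u ≤ q 0 + ⋯ + q k`. If `u` is uniform on `[0, 1]`, the index is `k` with probability `q k`,
see `volume_selectIndex`. (The value `0` for `u > 1` plays no role.) -/
def selectIndex {N : ℕ} [NeZero N] (q : Fin N → ℝ) (u : ℝ) : Fin N :=
  if h : ∃ k : Fin N, u ≤ ∑ j ∈ Finset.Iic k, q j then Fin.find _ h else 0

theorem volume_selectIndex {N : ℕ} [NeZero N] (q : Fin N → ℝ) (hq : ∀ k, 0 ≤ q k)
    (hsum : ∑ k, q k = 1) (k : Fin N) :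
    (volume : Measure ℝ).restrict (Icc (0 : ℝ) 1) {u | selectIndex q u = k}
      = ENNReal.ofReal (q k) := by
  have hIic : ∑ j ∈ Finset.Iic k, q j = ∑ j ∈ Finset.Iio k, q j + q k := by
    rw [← Finset.Iio_insert, Finset.sum_insert (by simp), add_comm]
  have h0 : 0 ≤ ∑ j ∈ Finset.Iio k, q j := Finset.sum_nonneg fun j _ => hq j
  have h1 : ∑ j ∈ Finset.Iic k, q j ≤ 1 := by
    rw [← hsum]
    exact Finset.sum_le_sum_of_subset_of_nonneg (Finset.subset_univ _) fun j _ _ => hq j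
  have hiff : ∀ u ∈ Ioc (0 : ℝ) 1, selectIndex q u = k ↔
      u ∈ Ioc (∑ j ∈ Finset.Iio k, q j) (∑ j ∈ Finset.Iic k, q j) := by
    intro u hu
    have hex : ∃ k : Fin N, u ≤ ∑ j ∈ Finset.Iic k, q j := by
      refine ⟨⟨N - 1, Nat.sub_lt (NeZero.pos N) one_pos⟩, ?_⟩
      have : Finset.Iic (⟨N - 1, Nat.sub_lt (NeZero.pos N) one_pos⟩ : Fin N) = Finset.univ := by
        ext j
        simp only [Finset.mem_Iic, Finset.mem_univ, iff_true, Fin.le_def]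
        omega
      rw [this, hsum]
      exact hu.2
    have hsel : selectIndex q u = k ↔
        u ≤ ∑ j ∈ Finset.Iic k, q j ∧ ∀ i < k, ¬ u ≤ ∑ j ∈ Finset.Iic i, q j := by
      unfold selectIndex
      rw [dif_pos hex, Fin.find_eq_iff]
    rw [hsel, mem_Ioc, and_comm]
    refine and_congr_left fun _ => ⟨fun h => ?_, fun h i hi hle => ?_⟩
    · rcases Nat.eq_zero_or_pos k.val with hk | hk
      · have : Finset.Iio k = ∅ := by
          ext j
          simp only [Finset.mem_Iio, Fin.lt_def, Finset.notMem_empty, iff_false]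
          omega
        rw [this, Finset.sum_empty]
        exact hu.1
      · have hlt : k.val - 1 < N := by omega
        have := h ⟨k.val - 1, hlt⟩ (by rw [Fin.lt_def]; simp only; omega)
        have he : Finset.Iic (⟨k.val - 1, hlt⟩ : Fin N) = Finset.Iio k := by
          ext j
          simp only [Finset.mem_Iic, Finset.mem_Iio, Fin.le_def, Fin.lt_def]
          omega
        rw [he] at this
        exact not_le.mp this
    · refine absurd (h.trans_le hle) (not_lt.mpr ?_)
      refine Finset.sum_le_sum_of_subset_of_nonneg (fun j hj => ?_) fun j _ _ => hq j
      simp only [Finset.mem_Iic, Finset.mem_Iio] at hj ⊢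
      exact lt_of_le_of_lt hj hi
  have hset : Ioc (0 : ℝ) 1 ∩ {u | selectIndex q u = k}
      = Ioc (∑ j ∈ Finset.Iio k, q j) (∑ j ∈ Finset.Iic k, q j) := by
    ext u
    refine ⟨fun h => (hiff u h.1).1 h.2, fun h => ?_⟩
    have hu : u ∈ Ioc (0 : ℝ) 1 := ⟨h0.trans_lt h.1, h.2.trans h1⟩
    exact ⟨hu, (hiff u hu).2 h⟩
  rw [← Measure.restrict_congr_set Ioc_ae_eq_Icc, Measure.restrict_apply' measurableSet_Ioc,
    inter_comm, hset, Real.volume_Ioc, hIic, add_sub_cancel_left]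

/-! ### The iterated function system with jumps -/

/-- The data of a place-dependent iterated function system with jumps: maps `w i`, a continuous
flow `S(t)`, `t ≥ 0`, place-dependent probability vectors `p · x`, and the jump rate `lam > 0`. -/
structure JumpIFS (X : Type*) [TopologicalSpace X] (N : ℕ) where
  /-- the transformations -/
  w : Fin N → X → X
  /-- the continuous flow -/
  S : Flow ℝ≥0 X
  /-- the place-dependent probabilities -/
  p : Fin N → X → ℝ
  p_nonneg : ∀ i x, 0 ≤ p i x
  p_sum : ∀ x, ∑ i, p i x = 1
  /-- the rate of the exponential waiting times -/
  lam : ℝ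
  lam_pos : 0 < lam

namespace JumpIFS

variable {X : Type*} [TopologicalSpace X] {N : ℕ} [NeZero N] (Q : JumpIFS X N)

/-- The jump times `τ_0 = 0`, `τ_n = Δτ_1 + ⋯ + Δτ_n`. -/
def jumpTime (b : Noise) (n : ℕ) : ℝ :=
  ∑ k ∈ Finset.range n, (b k).1

/-- The post-jump positions: `Φ_0 = x`, and `Φ_{n+1} = w_i(ξ)` where `ξ = S(Δτ_{n+1})(Φ_n)` and
the index `i` is chosen with probabilities `p(ξ)`. -/
def jumpState (x : X) (b : Noise) : ℕ → X
  | 0 => x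
  | n + 1 =>
    let y : X := Q.S (b n).1.toNNReal (jumpState x b n)
    Q.w (selectIndex (fun i => Q.p i y) (b n).2) y

/-- The number of jumps up to time `t`: the first `n` with `t < τ_{n+1}`; thus
`τ_n ≤ t < τ_{n+1}` (almost surely such an `n` exists). -/
def jumpCount (b : Noise) (t : ℝ≥0) : ℕ :=
  sInf {n : ℕ | (t : ℝ) < jumpTime b (n + 1)}

/-- The process started at `x`: `Φ(t) = S(t - τ_n)(Φ_n)` for `τ_n ≤ t < τ_{n+1}`. -/
def process (x : X) (t : ℝ≥0) (b : Noise) : X :=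
  Q.S ((t : ℝ) - jumpTime b (jumpCount b t)).toNNReal (Q.jumpState x b (jumpCount b t))

/-- The transition functions `P_t(x, ·)`: the law of `Φ(t)` started at `x`, so that
`P_t f(x) = ∫ f dP_t(x, ·) = 𝔼 f(Φ(t))`. -/
def semigroup [MeasurableSpace X] (t : ℝ≥0) (x : X) : Measure X :=
  (noiseLaw Q.lam).map (Q.process x t)

/-- `w_{i[k]}(x) = (w_{i_1} ∘ ⋯ ∘ w_{i_k})(x)` for a word `i = (i_1, …, i_n)`; for `k = 0` this
is `x`. -/
def prefixMap {n : ℕ} (i : Fin n → Fin N) (k : ℕ) (x : X) : X :=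
  ((List.ofFn i).take k).foldr Q.w x

/-- `J_n(x) = max_{i ∈ I^n} ∏_{j=0}^{n-1} r(w_{i[j]}(x))`. -/
def maxContraction (r : X → ℝ) (n : ℕ) (x : X) : ℝ :=
  ⨆ i : Fin n → Fin N, ∏ j ∈ Finset.range n, r (Q.prefixMap i j x)

end JumpIFS

end

/-!
The invariant measure is the point mass at `z`, and everything comes down to showing that the
process converges to `z` in probability from every starting point.

*Local contraction.* If `α > 0` and `z` is an accumulation point, then `r z ≤ (lam - α) / lam`.
Otherwise `r` would exceed `(lam - α) / lam` by a factor on a whole ball around `z`. With letters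
drawn independently with the probabilities `p i z`, the mean distance to `z` is expanded by at most
a factor `C` arbitrarily close to one while the points remain near `z`. Hence, for `x` at distance
`ρ` from `z`, by a union bound over the prefixes there are words of length of order `log (1 / ρ)`
all of whose prefix maps send `x` into the ball (`JumpIFS.exists_word_forall_prefixMap_lt_one`). Then
many terms of the series in the summability condition exceed a fixed positive number, which is
absurd (`JumpIFS.r_mul_le_of_summable`). Since `√(1 - a) < 1 - a / 2`, the inequality
`√(r x) ≤ 1 - α / (2 lam)` follows for `x` near `z`, `x ≠ z` (`JumpIFS.exists_forall_r_le`). If `z`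
is isolated this is empty, and if `α = 0` it is `r ≤ 1`.

*Lyapunov function.* By Cauchy–Schwarz, near `z` the function `√(dist x z)` is contracted in mean at
a jump by the factor `1 - α / (2 lam)`, while along the flow it grows at rate at most `α / 2`. These
balance exactly for waiting times of rate `lam`, so the bounded function `φ = min (√(dist x z)) b`
does not grow in mean up to the first jump (`JumpIFS.renewal_potential_le`).

*Renewal equation.* Conditioning on the first waiting time gives an integral equation for `P_t f`,
in `t` and the starting point (`JumpIFS.lintegral_semigroup_eq_renewal`). A comparison principle for
it (`JumpIFS.le_of_le_renewal_of_renewal_le`) yields that only finitely many jumps occur in finite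
time, the Chapman–Kolmogorov equation (`JumpIFS.lintegral_semigroup_add`), and `P_t φ ≤ φ`.

*Conclusion.* As `P_t φ ≤ φ`, the functions `P_t φ` decrease to a limit, and the uniform
accessibility of the neighbourhoods of `z` forces the limit to vanish
(`tendsto_lintegral_zero_of_excessive`). This is convergence to `z` in probability.
-/

/-! ### Words with controlled prefix maps -/

namespace JumpIFS

variable {X : Type*} {N : ℕ}

section Words

variable [TopologicalSpace X] (Q : JumpIFS X N)

theorem prefixMap_zero {n : ℕ} (i : Fin n → Fin N) (x : X) : Q.prefixMap i 0 x = x := by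
  simp [prefixMap]

/-- The first letter of a word is the outermost one: it is applied last. -/
theorem prefixMap_cons_succ {n : ℕ} (a : Fin N) (i : Fin n → Fin N) (j : ℕ) (x : X) :
    Q.prefixMap (Fin.cons a i : Fin (n + 1) → Fin N) (j + 1) x = Q.w a (Q.prefixMap i j x) := by
  simp [prefixMap]

theorem sum_wordWeight {π : Fin N → ℝ} (hπ : ∑ a, π a = 1) (n : ℕ) :
    ∑ i : Fin n → Fin N, ∏ k, π (i k) = 1 := by
  have := Finset.prod_univ_sum (fun _ : Fin n => (Finset.univ : Finset (Fin N))) (fun _ a => π a)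
  simp only [hπ, Finset.prod_const_one, Fintype.piFinset_univ] at this
  exact this.symm

/-- If the averaging operator `g ↦ ∑ a, π a * g ∘ w a` expands `h` at most by the factor `C`, then
under independent letters of law `π` the mean of `h` at the `j`-th prefix map is at most
`C ^ j * h x`. The function `g` makes the induction on `j` go through: the outermost letter is
absorbed in it. -/
theorem sum_wordWeight_mul_prefixMap_le {π : Fin N → ℝ} (hπ0 : ∀ a, 0 ≤ π a)
    (hπ : ∑ a, π a = 1) {h : X → ℝ} {C : ℝ} (hC0 : 0 ≤ C)
    (hC : ∀ x, ∑ a, π a * h (Q.w a x) ≤ C * h x) (j : ℕ) :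
    ∀ (n : ℕ), j ≤ n → ∀ (g : X → ℝ) (D : ℝ), 0 ≤ D → (∀ y, g y ≤ D * h y) → ∀ x,
      ∑ i : Fin n → Fin N, (∏ k, π (i k)) * g (Q.prefixMap i j x) ≤ D * C ^ j * h x := by
  induction j with
  | zero =>
    intro n _ g D _ hg x
    simp only [prefixMap_zero, ← Finset.sum_mul, sum_wordWeight hπ, one_mul, pow_zero, mul_one]
    exact hg x
  | succ j ih =>
    intro n hn g D hD hg x
    obtain ⟨m, rfl⟩ : ∃ m, n = m + 1 := ⟨n - 1, by omega⟩
    have key : ∑ i : Fin (m + 1) → Fin N, (∏ k, π (i k)) * g (Q.prefixMap i (j + 1) x)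
        = ∑ i : Fin m → Fin N, (∏ k, π (i k)) *
          (fun y => ∑ a, π a * g (Q.w a y)) (Q.prefixMap i j x) := by
      rw [← (Fin.consEquiv fun _ => Fin N).sum_comp, Fintype.sum_prod_type, Finset.sum_comm]
      refine Finset.sum_congr rfl fun i _ => ?_
      rw [Finset.mul_sum]
      refine Finset.sum_congr rfl fun a _ => ?_
      change (∏ k, π ((Fin.cons a i : Fin (m + 1) → Fin N) k)) *
        g (Q.prefixMap (Fin.cons a i : Fin (m + 1) → Fin N) (j + 1) x) = _
      simp only [Fin.prod_univ_succ, Fin.cons_zero, Fin.cons_succ, prefixMap_cons_succ]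
      ring
    rw [key]
    have := ih m (by omega) (fun y => ∑ a, π a * g (Q.w a y)) (D * C) (mul_nonneg hD hC0)
      (fun y => ?_) x
    · refine this.trans_eq ?_
      ring
    · calc ∑ a, π a * g (Q.w a y) ≤ ∑ a, π a * (D * h (Q.w a y)) :=
            Finset.sum_le_sum fun a _ => mul_le_mul_of_nonneg_left (hg _) (hπ0 a)
        _ = D * ∑ a, π a * h (Q.w a y) := by
            rw [Finset.mul_sum]; exact Finset.sum_congr rfl fun a _ => by ring
        _ ≤ D * (C * h y) := mul_le_mul_of_nonneg_left (hC y) hD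
        _ = D * C * h y := by ring

/-- The probabilistic method: some word has all its prefix maps in the region `h < 1`. -/
theorem exists_word_forall_prefixMap_lt_one {π : Fin N → ℝ} (hπ0 : ∀ a, 0 ≤ π a)
    (hπ : ∑ a, π a = 1) {h : X → ℝ} (h0 : ∀ x, 0 ≤ h x) {C : ℝ} (hC1 : 1 ≤ C)
    (hC : ∀ x, ∑ a, π a * h (Q.w a x) ≤ C * h x) (n : ℕ) (x : X) (hn : n * C ^ n * h x < 1) :
    ∃ i : Fin n → Fin N, ∀ j < n, h (Q.prefixMap i j x) < 1 := by
  have hC0 : 0 ≤ C := zero_le_one.trans hC1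
  have hmean : ∑ i : Fin n → Fin N, (∏ k, π (i k)) *
      ∑ j ∈ Finset.range n, h (Q.prefixMap i j x) < 1 := by
    simp only [Finset.mul_sum]
    rw [Finset.sum_comm]
    refine lt_of_le_of_lt ?_ hn
    calc _ ≤ ∑ j ∈ Finset.range n, C ^ n * h x := by
          refine Finset.sum_le_sum fun j hj => ?_
          have hj' := (Finset.mem_range.1 hj).le
          refine (sum_wordWeight_mul_prefixMap_le Q hπ0 hπ hC0 hC j n hj' h 1 zero_le_one
            (fun y => by simp) x).trans ?_
          rw [one_mul]
          exact mul_le_mul_of_nonneg_right (pow_le_pow_right₀ hC1 hj') (h0 x)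
      _ = n * C ^ n * h x := by simp [mul_assoc]
  by_contra! hcon
  refine absurd hmean (not_lt.2 ?_)
  rw [← sum_wordWeight hπ n]
  refine Finset.sum_le_sum fun i _ => ?_
  obtain ⟨j, hj, hj1⟩ := hcon i
  refine le_mul_of_one_le_right (Finset.prod_nonneg fun k _ => hπ0 _) (hj1.trans ?_)
  exact Finset.single_le_sum (f := fun j => h (Q.prefixMap i j x)) (fun j _ => h0 _)
    (Finset.mem_range.2 hj)

end Words

/-! ### Local contraction near the fixed point -/

variable [MetricSpace X] (Q : JumpIFS X N) {z : X} {r : X → ℝ} {ω : ℝ → ℝ} {α : ℝ}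

/-- Near `z`, the letters drawn with the probabilities at `z` (not at the current point) expand
the mean distance to `z` by at most any prescribed factor larger than one. -/
theorem eventually_sum_p_mul_dist_le (hp : ∀ i, Continuous (Q.p i)) (hr1 : ∀ x, r x ≤ 1)
    (hcontr : ∀ x, ∑ i, Q.p i x * dist (Q.w i x) z ≤ r x * dist x z) {C : ℝ} (hC : 1 < C) :
    ∀ᶠ x in 𝓝 z, ∑ i, Q.p i z * dist (Q.w i x) z ≤ C * dist x z := by
  have hev : ∀ᶠ x in 𝓝 z, ∀ i, Q.p i z ≤ C * Q.p i x := by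
    refine eventually_all.2 fun i => ?_
    rcases (Q.p_nonneg i z).eq_or_lt with h0 | h0
    · exact Eventually.of_forall fun x => by
        rw [← h0]; exact mul_nonneg (by linarith) (Q.p_nonneg i x)
    · have hc : Continuous fun x => C * Q.p i x := continuous_const.mul (hp i)
      have : Q.p i z < C * Q.p i z := by nlinarith
      exact (hc.continuousAt.eventually (lt_mem_nhds this)).mono fun x hx => le_of_lt hx
  filter_upwards [hev] with x hx
  calc ∑ i, Q.p i z * dist (Q.w i x) z ≤ ∑ i, C * (Q.p i x * dist (Q.w i x) z) :=
        Finset.sum_le_sum fun i _ => by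
          rw [← mul_assoc]; exact mul_le_mul_of_nonneg_right (hx i) dist_nonneg
    _ = C * ∑ i, Q.p i x * dist (Q.w i x) z := by rw [Finset.mul_sum]
    _ ≤ C * (r x * dist x z) := mul_le_mul_of_nonneg_left (hcontr x) (by linarith)
    _ ≤ C * dist x z := mul_le_mul_of_nonneg_left
        (mul_le_of_le_one_left dist_nonneg (hr1 x)) (by linarith)

theorem pow_le_maxContraction {n : ℕ} {x : X} {s : ℝ} (hs : 0 ≤ s)
    (i : Fin n → Fin N) (hi : ∀ j < n, s ≤ r (Q.prefixMap i j x)) :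
    s ^ n ≤ Q.maxContraction r n x := by
  refine le_trans ?_ (le_ciSup (f := fun i : Fin n → Fin N =>
    ∏ j ∈ Finset.range n, r (Q.prefixMap i j x)) (Set.finite_range _).bddAbove i)
  calc s ^ n = ∏ _j ∈ Finset.range n, s := by simp
    _ ≤ _ := Finset.prod_le_prod (fun _ _ => hs) fun j hj => hi j (Finset.mem_range.1 hj)

/-- If `z` is an accumulation point and the flow may expand, then the summability condition forces
`r z ≤ (lam - α) / lam`. Otherwise, starting at a point `x` very close to `z`, there are words
whose prefix maps all stay in a neighbourhood of `z` on which `r` exceeds `(lam - α) / lam`, for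
so long that many terms of the series are at least `ω s > 0`. -/
theorem r_mul_le_of_summable [(𝓝[≠] z).NeBot]
    (hp : ∀ i, Continuous (Q.p i)) (hr : Continuous r) (hr_mem : ∀ x, r x ∈ Ioc (0 : ℝ) 1)
    (hcontr : ∀ x, ∑ i, Q.p i x * dist (Q.w i x) z ≤ r x * dist x z)
    (hω_mono : MonotoneOn ω (Ici 0)) (hω_zero : ω 0 = 0)
    (hα_lt : α < Q.lam) (hω_ne : ∃ s, 0 ≤ s ∧ ω s ≠ 0)
    (hsum : ∃ M : ℕ, ∃ η > (0 : ℝ), ∃ γ ∈ Ioo (0 : ℝ) 1, ∀ x ∈ Metric.ball z η,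
      Summable (fun n : ℕ => ω (Q.maxContraction r (M + n) x * dist x z *
        (Q.lam ^ (M + n) / (Q.lam - α) ^ (M + n)))) ∧
      ∑' n : ℕ, ω (Q.maxContraction r (M + n) x * dist x z *
        (Q.lam ^ (M + n) / (Q.lam - α) ^ (M + n))) ≤ 1 - γ) :
    r z ≤ (Q.lam - α) / Q.lam := by
  by_contra! hrz
  obtain ⟨M, η, hη, γ, hγ, hsum⟩ := hsum
  obtain ⟨s, hs0, hωs⟩ := hω_ne
  have hs : 0 < s := hs0.lt_of_ne fun h => hωs (h ▸ hω_zero)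
  have hκ : 0 < ω s := (hω_zero.symm.le.trans
    (hω_mono self_mem_Ici hs0 hs0)).lt_of_ne (Ne.symm hωs)
  obtain ⟨K, hK⟩ := exists_nat_gt (1 / ω s)
  have hlam := Q.lam_pos
  have hla : 0 < Q.lam - α := sub_pos.2 hα_lt
  obtain ⟨r₁, hr₁, hr₁z⟩ := exists_between hrz
  have hr₁0 : 0 < r₁ := lt_trans (by positivity) hr₁
  set c : ℝ := Q.lam / (Q.lam - α) with hc
  set q : ℝ := r₁ * c with hq
  have hq1 : 1 < q := by
    rw [hq, hc, ← mul_div_assoc, one_lt_div hla]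
    rwa [div_lt_iff₀ hlam] at hr₁
  obtain ⟨C, hC1, hCq⟩ := exists_between hq1
  have hq0 : 0 < q := zero_lt_one.trans hq1
  have hC0 : 0 < C := zero_lt_one.trans hC1
  -- the neighbourhood `ball z u` in which the prefix maps are to stay
  obtain ⟨u, hu, hball⟩ := Metric.eventually_nhds_iff_ball.1
    ((hr.continuousAt.eventually (lt_mem_nhds hr₁z)).and
      (Q.eventually_sum_p_mul_dist_le hp (fun x => (hr_mem x).2) hcontr hC1))
  set h : X → ℝ := fun x => min 1 (dist x z / u) with hh
  have hh0 : ∀ x, 0 ≤ h x := fun x => le_min zero_le_one (by positivity)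
  have hhC : ∀ x, ∑ a, Q.p a z * h (Q.w a x) ≤ C * h x := by
    intro x
    by_cases hx : dist x z < u
    · have hhx : h x = dist x z / u := min_eq_right ((div_lt_one hu).2 hx).le
      calc ∑ a, Q.p a z * h (Q.w a x) ≤ ∑ a, Q.p a z * (dist (Q.w a x) z / u) :=
            Finset.sum_le_sum fun a _ =>
              mul_le_mul_of_nonneg_left (min_le_right _ _) (Q.p_nonneg a z)
        _ = (∑ a, Q.p a z * dist (Q.w a x) z) / u := by
            rw [Finset.sum_div]; exact Finset.sum_congr rfl fun a _ => by ring
        _ ≤ C * dist x z / u := div_le_div_of_nonneg_right (hball x hx).2 hu.le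
        _ = C * h x := by rw [hhx]; ring
    · have hhx : h x = 1 := min_eq_left ((one_le_div hu).2 (not_lt.1 hx))
      calc ∑ a, Q.p a z * h (Q.w a x) ≤ ∑ a, Q.p a z * 1 :=
            Finset.sum_le_sum fun a _ =>
              mul_le_mul_of_nonneg_left (min_le_left _ _) (Q.p_nonneg a z)
        _ = 1 := by simp [Q.p_sum z]
        _ ≤ C * h x := by rw [hhx]; linarith
  -- words of length `n + 1 + K` stay in the neighbourhood if `dist x z` is at most `s / q ^ n`
  have hlim : Tendsto (fun L : ℕ => (s * q ^ (1 + K) / u) * (L * (C / q) ^ L)) atTop (𝓝 0) := by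
    simpa using (tendsto_self_mul_const_pow_of_lt_one (by positivity)
      ((div_lt_one hq0).2 hCq)).const_mul (s * q ^ (1 + K) / u)
  obtain ⟨n₁, hn₁⟩ := eventually_atTop.1 (hlim.eventually (gt_mem_nhds zero_lt_one))
  obtain ⟨x, ⟨hxη, hxs⟩, hxz⟩ : ∃ x, (dist x z < η ∧ dist x z < s / q ^ (n₁ + 1 + M)) ∧ x ≠ z := by
    have h1 : ∀ᶠ x in 𝓝 z, dist x z < η ∧ dist x z < s / q ^ (n₁ + 1 + M) :=
      (Metric.eventually_nhds_iff_ball.2 ⟨η, hη, fun _ h => h⟩).and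
        (Metric.eventually_nhds_iff_ball.2 ⟨_, by positivity, fun _ h => h⟩)
    exact ((h1.filter_mono nhdsWithin_le_nhds).and
      (eventually_mem_nhdsWithin (s := {z}ᶜ))).exists
  have hρ : 0 < dist x z := dist_pos.2 hxz
  have hbig : q ^ (n₁ + 1 + M) < s / dist x z := by
    rw [lt_div_iff₀ hρ]; rwa [lt_div_iff₀ (by positivity), mul_comm] at hxs
  obtain ⟨n, hn, hn'⟩ := exists_nat_pow_near (x := s / dist x z)
    ((one_le_pow₀ hq1.le).trans hbig.le) hq1
  have hnn : n₁ + M ≤ n := by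
    have := (pow_lt_pow_iff_right₀ hq1).1 (hbig.trans hn')
    omega
  have hword : ∀ m ≤ n + 1 + K, r₁ ^ m ≤ Q.maxContraction r m x := by
    intro m hm
    have hsmall : m * C ^ m * h x < 1 := by
      set L := n + 1 + K with hL
      have hρ' : dist x z ≤ s / q ^ n := by
        rw [le_div_iff₀ (by positivity), mul_comm]; rwa [le_div_iff₀ hρ] at hn
      calc (m : ℝ) * C ^ m * h x ≤ L * C ^ L * (s / q ^ n / u) := by
            have h1 : (m : ℝ) ≤ L := by exact_mod_cast hm
            have h2 : C ^ m ≤ C ^ L := pow_le_pow_right₀ hC1.le hm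
            have h3 : h x ≤ s / q ^ n / u :=
              (min_le_right _ _).trans (div_le_div_of_nonneg_right hρ' hu.le)
            have := hh0 x
            gcongr
        _ = (s * q ^ (1 + K) / u) * (L * (C / q) ^ L) := by
            have : q ^ L = q ^ n * q ^ (1 + K) := by rw [hL, ← pow_add]; ring_nf
            rw [div_pow, this]
            field_simp
        _ < 1 := hn₁ L (by omega)
    obtain ⟨i, hi⟩ := Q.exists_word_forall_prefixMap_lt_one (fun a => Q.p_nonneg a z)
      (Q.p_sum z) hh0 hC1.le hhC m x hsmall
    refine Q.pow_le_maxContraction hr₁0.le i fun j hj => ?_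
    have hlt := hi j hj
    rw [hh, min_lt_iff] at hlt
    have : dist (Q.prefixMap i j x) z < u :=
      (div_lt_one hu).1 (hlt.resolve_left (lt_irrefl _))
    exact (hball _ this).1.le
  have hJ0 : ∀ m, 0 ≤ Q.maxContraction r m x := fun m =>
    Real.iSup_nonneg fun i => Finset.prod_nonneg fun j _ => (hr_mem _).1.le
  -- the `K` terms in which `maxContraction` has an index `n + 1, …, n + K` are at least `ω s` each
  have hterm : ∀ m ∈ Finset.Ico (n + 1 - M) (n + 1 - M + K),
      ω s ≤ ω (Q.maxContraction r (M + m) x * dist x z *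
        (Q.lam ^ (M + m) / (Q.lam - α) ^ (M + m))) := by
    intro m hm
    rw [Finset.mem_Ico] at hm
    have hle : s ≤ Q.maxContraction r (M + m) x * dist x z *
        (Q.lam ^ (M + m) / (Q.lam - α) ^ (M + m)) := by
      calc s ≤ q ^ (n + 1) * dist x z := ((div_lt_iff₀ hρ).1 hn').le
        _ ≤ q ^ (M + m) * dist x z :=
            mul_le_mul_of_nonneg_right (pow_le_pow_right₀ hq1.le (by omega)) hρ.le
        _ = r₁ ^ (M + m) * dist x z * (Q.lam ^ (M + m) / (Q.lam - α) ^ (M + m)) := by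
            rw [hq, hc, mul_pow, div_pow]; ring
        _ ≤ _ := by
            have := hword (M + m) (by omega)
            gcongr
    exact hω_mono hs0 (hs0.trans hle) hle
  obtain ⟨hsm, hle⟩ := hsum x hxη
  have hfin := hsm.sum_le_tsum (Finset.Ico (n + 1 - M) (n + 1 - M + K)) fun m _ => by
    have h0 : 0 ≤ Q.maxContraction r (M + m) x * dist x z *
        (Q.lam ^ (M + m) / (Q.lam - α) ^ (M + m)) := by
      have := hJ0 (M + m)
      positivity
    exact hω_zero.symm.le.trans (hω_mono self_mem_Ici h0 h0)
  have hcard := Finset.card_nsmul_le_sum _ _ _ hterm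
  simp only [Nat.card_Ico, add_tsub_cancel_left, nsmul_eq_mul] at hcard
  have : 1 < K * ω s := (div_lt_iff₀ hκ).1 hK
  have := hγ.1
  linarith

/-- The local contraction from which everything else follows: near `z` the square root of the
distance to `z` contracts in mean at the jumps by a factor that makes up for its growth at rate
`α / 2` along the flow. The square root gives room: `√(1 - a) < 1 - a / 2`, so that the bound
`r z ≤ 1 - α / lam` is enough. -/
theorem exists_forall_r_le (hp : ∀ i, Continuous (Q.p i)) (hr : Continuous r)
    (hr_mem : ∀ x, r x ∈ Ioc (0 : ℝ) 1)
    (hcontr : ∀ x, ∑ i, Q.p i x * dist (Q.w i x) z ≤ r x * dist x z)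
    (hω_mono : MonotoneOn ω (Ici 0)) (hω_zero : ω 0 = 0)
    (hα : 0 ≤ α) (hα_lt : α < Q.lam) (hω_ne : 0 < α → ∃ s, 0 ≤ s ∧ ω s ≠ 0)
    (hsum : ∃ M : ℕ, ∃ η > (0 : ℝ), ∃ γ ∈ Ioo (0 : ℝ) 1, ∀ x ∈ Metric.ball z η,
      Summable (fun n : ℕ => ω (Q.maxContraction r (M + n) x * dist x z *
        (Q.lam ^ (M + n) / (Q.lam - α) ^ (M + n)))) ∧
      ∑' n : ℕ, ω (Q.maxContraction r (M + n) x * dist x z *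
        (Q.lam ^ (M + n) / (Q.lam - α) ^ (M + n))) ≤ 1 - γ) :
    ∃ u > 0, ∀ x, dist x z ≤ u → x ≠ z → r x ≤ ((Q.lam - α / 2) / Q.lam) ^ 2 := by
  suffices h : ∀ᶠ x in 𝓝[≠] z, r x ≤ ((Q.lam - α / 2) / Q.lam) ^ 2 by
    obtain ⟨u, hu, hball⟩ := Metric.eventually_nhds_iff_ball.1 (eventually_nhdsWithin_iff.1 h)
    exact ⟨u / 2, half_pos hu, fun x hx hxz =>
      hball x (lt_of_le_of_lt hx (half_lt_self hu)) hxz⟩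
  rcases (𝓝[≠] z).eq_or_neBot with hbot | hne
  · rw [hbot]; exact eventually_bot
  have hlam := Q.lam_pos
  rcases hα.eq_or_lt with rfl | hα0
  · refine Eventually.of_forall fun x => ?_
    simpa [div_self hlam.ne'] using (hr_mem x).2
  · have hle := Q.r_mul_le_of_summable hp hr hr_mem hcontr hω_mono hω_zero hα_lt (hω_ne hα0) hsum
    have hlt : r z < ((Q.lam - α / 2) / Q.lam) ^ 2 := by
      refine hle.trans_lt ?_
      rw [div_pow, div_lt_div_iff₀ hlam (by positivity)]
      have : 0 < Q.lam * α ^ 2 := by positivity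
      nlinarith
    exact ((hr.continuousAt.eventually (gt_mem_nhds hlt)).filter_mono nhdsWithin_le_nhds).mono
      fun x hx => le_of_lt hx

end JumpIFS

/-! ### The exponential law -/

theorem expMeasure_Iic {l t : ℝ} (hl : 0 < l) (ht : 0 ≤ t) :
    expMeasure l (Iic t) = ENNReal.ofReal (1 - Real.exp (-(l * t))) := by
  have := isProbabilityMeasure_expMeasure hl
  rw [← ofReal_cdf, cdf_expMeasure_eq hl, if_pos ht]

theorem ae_nonneg_expMeasure {l : ℝ} (hl : 0 < l) : ∀ᵐ s ∂expMeasure l, 0 ≤ s := by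
  rw [ae_iff]
  refine measure_mono_null (t := Iic 0) (fun s hs => ?_) (by simp [expMeasure_Iic hl le_rfl])
  exact (not_le.1 (by simpa using hs)).le

theorem expMeasure_Ioi {l t : ℝ} (hl : 0 < l) (ht : 0 ≤ t) :
    expMeasure l (Ioi t) = ENNReal.ofReal (Real.exp (-(l * t))) := by
  have := isProbabilityMeasure_expMeasure hl
  rw [← compl_Iic, prob_compl_eq_one_sub measurableSet_Iic, expMeasure_Iic hl ht,
    ← ENNReal.ofReal_one, ← ENNReal.ofReal_sub _ (by simp; positivity)]
  ring_nf

/-- The exponential law is memoryless. -/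
theorem restrict_Ioi_expMeasure {l t : ℝ} (hl : 0 < l) (ht : 0 ≤ t) :
    (expMeasure l).restrict (Ioi t)
      = expMeasure l (Ioi t) • (expMeasure l).map (fun s => t + s) := by
  have := isProbabilityMeasure_expMeasure hl
  have hmeas : Measurable fun s : ℝ => t + s := measurable_const_add t
  have : IsFiniteMeasure (expMeasure l (Ioi t) • (expMeasure l).map (fun s => t + s)) :=
    ⟨by simp [Measure.map_apply hmeas MeasurableSet.univ]⟩
  refine Measure.ext_of_Iic _ _ fun a => ?_
  rw [Measure.restrict_apply measurableSet_Iic, Measure.smul_apply,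
    Measure.map_apply hmeas measurableSet_Iic, smul_eq_mul]
  have hpre : (fun s => t + s) ⁻¹' Iic a = Iic (a - t) := by
    ext s; simp [le_sub_iff_add_le, add_comm]
  rw [hpre, inter_comm, Ioi_inter_Iic]
  rcases le_or_gt t a with h | h
  · have hdiff : Ioc t a = Iic a \ Iic t := by ext s; simp [and_comm]
    rw [hdiff, measure_sdiff (Iic_subset_Iic.2 h) measurableSet_Iic.nullMeasurableSet
      (measure_ne_top _ _), expMeasure_Iic hl ht, expMeasure_Iic hl (ht.trans h),
      expMeasure_Ioi hl ht, expMeasure_Iic hl (sub_nonneg.2 h),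
      ← ENNReal.ofReal_sub _ (by simp; positivity), ← ENNReal.ofReal_mul (by positivity),
      mul_sub, ← Real.exp_add]
    ring_nf
  · rw [Ioc_eq_empty h.not_gt, measure_empty, measure_mono_null (t := Iic 0)
      (Iic_subset_Iic.2 (by linarith)) (by simp [expMeasure_Iic hl le_rfl]), mul_zero]

theorem setLIntegral_Ioi_expMeasure {l t : ℝ} (hl : 0 < l) (ht : 0 ≤ t) (G : ℝ → ℝ≥0∞) :
    ∫⁻ s in Ioi t, G s ∂expMeasure l
      = expMeasure l (Ioi t) * ∫⁻ s, G (t + s) ∂expMeasure l := by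
  rw [restrict_Ioi_expMeasure hl ht, lintegral_smul_measure, smul_eq_mul]
  congr 1
  exact lintegral_map_equiv G (MeasurableEquiv.addLeft t)

instance isProbabilityMeasure_restrict_Icc_zero_one :
    IsProbabilityMeasure ((volume : Measure ℝ).restrict (Icc (0 : ℝ) 1)) :=
  ⟨by simp⟩

/-! ### Splitting off the first step of the noise -/

/-- The noise whose first step is `h`, followed by the steps of `b`. -/
def noiseCons (h : ℝ × ℝ) (b : Noise) : Noise
  | 0 => h
  | n + 1 => b n

theorem measurable_noiseCons : Measurable fun p : (ℝ × ℝ) × Noise => noiseCons p.1 p.2 := by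
  refine measurable_pi_lambda _ fun n => ?_
  cases n with
  | zero => exact measurable_fst
  | succ n => exact (measurable_pi_apply n).comp measurable_snd

theorem isProbabilityMeasure_noiseLaw {l : ℝ} (hl : 0 < l) :
    IsProbabilityMeasure (noiseLaw l) := by
  have := isProbabilityMeasure_expMeasure hl
  unfold noiseLaw
  infer_instance

/-- The noise consists of its first step and an independent copy of the whole noise. -/
theorem map_noiseCons {l : ℝ} (hl : 0 < l) :
    (((expMeasure l).prod ((volume : Measure ℝ).restrict (Icc (0 : ℝ) 1))).prod
      (noiseLaw l)).map (fun p => noiseCons p.1 p.2) = noiseLaw l := by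
  have := isProbabilityMeasure_expMeasure hl
  have := isProbabilityMeasure_noiseLaw hl
  refine Measure.eq_infinitePi _ fun s t ht => ?_
  classical
  obtain ⟨n, hn⟩ : ∃ n, s ⊆ Finset.range (n + 1) :=
    ⟨s.sup id, fun i hi => Finset.mem_range.2 (Nat.lt_succ_of_le (Finset.le_sup (f := id) hi))⟩
  set t' : ℕ → Set (ℝ × ℝ) := fun i => if i ∈ s then t i else univ with ht'
  have ht'm : ∀ i, MeasurableSet (t' i) := fun i => by
    rw [ht']; dsimp only; split_ifs
    exacts [ht i, MeasurableSet.univ]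
  have hpi : Set.pi (s : Set ℕ) t = Set.pi (Finset.range (n + 1) : Set ℕ) t' := by
    ext b
    simp only [Set.mem_pi, Finset.mem_coe, ht']
    refine ⟨fun h i _ => ?_, fun h i hi => ?_⟩
    · split_ifs with his
      exacts [h i his, mem_univ _]
    · simpa [hi] using h i (hn hi)
  have hprod : ∏ i ∈ s, ((expMeasure l).prod ((volume : Measure ℝ).restrict (Icc (0 : ℝ) 1))) (t i)
      = ∏ i ∈ Finset.range (n + 1),
        ((expMeasure l).prod ((volume : Measure ℝ).restrict (Icc (0 : ℝ) 1))) (t' i) := by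
    rw [← Finset.prod_subset hn fun i _ hi => by simp [ht', hi]]
    exact Finset.prod_congr rfl fun i hi => by simp [ht', hi]
  have hpre : (fun p : (ℝ × ℝ) × Noise => noiseCons p.1 p.2) ⁻¹'
      Set.pi (Finset.range (n + 1) : Set ℕ) t'
      = t' 0 ×ˢ Set.pi (Finset.range n : Set ℕ) (fun i => t' (i + 1)) := by
    ext ⟨h, b⟩
    simp only [mem_preimage, Set.mem_pi, Finset.mem_coe, Finset.mem_range, mem_prod]
    refine ⟨fun H => ⟨H 0 (Nat.succ_pos n), fun i hi => H (i + 1) (by omega)⟩, fun H i hi => ?_⟩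
    cases i with
    | zero => exact H.1
    | succ i => exact H.2 i (by omega)
  rw [hprod, hpi, Measure.map_apply measurable_noiseCons
    (MeasurableSet.pi (Finset.countable_toSet _) fun i _ => ht'm i), hpre, Measure.prod_prod,
    noiseLaw, Measure.infinitePi_pi _ fun i _ => ht'm (i + 1), Finset.prod_range_succ', mul_comm]

theorem lintegral_noiseLaw {l : ℝ} (hl : 0 < l) {F : Noise → ℝ≥0∞} (hF : Measurable F) :
    ∫⁻ b, F b ∂noiseLaw l = ∫⁻ s, (∫⁻ u in Icc (0 : ℝ) 1, ∫⁻ b, F (noiseCons (s, u) b)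
      ∂noiseLaw l) ∂expMeasure l := by
  have := isProbabilityMeasure_expMeasure hl
  have := isProbabilityMeasure_noiseLaw hl
  have hFm := hF.comp measurable_noiseCons
  conv_lhs => rw [← map_noiseCons hl]
  rw [lintegral_map hF measurable_noiseCons]
  change ∫⁻ v, (F ∘ fun p : (ℝ × ℝ) × Noise => noiseCons p.1 p.2) v ∂_ = _
  rw [lintegral_prod _ hFm.aemeasurable,
    lintegral_prod _ (hFm.lintegral_prod_right').aemeasurable]
  rfl

/-! ### Measurability of the process -/

theorem measurable_selectIndex {N : ℕ} [NeZero N] :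
    Measurable fun v : (Fin N → ℝ) × ℝ => selectIndex v.1 v.2 := by
  classical
  have hm : ∀ k : Fin N, MeasurableSet
      {v : (Fin N → ℝ) × ℝ | v.2 ≤ ∑ j ∈ Finset.Iic k, v.1 j} := fun k =>
    measurableSet_le measurable_snd
      (Finset.measurable_fun_sum _ fun j _ => (measurable_pi_apply j).comp measurable_fst)
  refine measurable_to_countable' fun k => ?_
  have hset : (fun v : (Fin N → ℝ) × ℝ => selectIndex v.1 v.2) ⁻¹' {k}
      = ({v | v.2 ≤ ∑ j ∈ Finset.Iic k, v.1 j} ∩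
          ⋂ i : Fin N, ⋂ _ : i < k, {v | v.2 ≤ ∑ j ∈ Finset.Iic i, v.1 j}ᶜ) ∪
        ({_v | k = 0} ∩ ⋂ i : Fin N, {v | v.2 ≤ ∑ j ∈ Finset.Iic i, v.1 j}ᶜ) := by
    ext v
    simp only [mem_preimage, mem_singleton_iff, mem_union, mem_inter_iff, mem_iInter,
      mem_compl_iff, mem_ofPred_eq]
    unfold selectIndex
    split_ifs with h
    · rw [Fin.find_eq_iff]
      refine ⟨Or.inl, fun H => H.elim id fun H => ?_⟩
      exact absurd h (not_exists.2 H.2)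
    · refine ⟨fun H => Or.inr ⟨H.symm, not_exists.1 h⟩, fun H => H.elim (fun H => ?_) fun H => ?_⟩
      · exact absurd ⟨k, H.1⟩ h
      · exact H.1.symm
  rw [hset]
  exact ((hm k).inter (.iInter fun i => .iInter fun _ => (hm i).compl)).union
    ((MeasurableSet.const _).inter (.iInter fun i => (hm i).compl))

namespace JumpIFS

theorem jumpTime_noiseCons (h : ℝ × ℝ) (b : Noise) (n : ℕ) :
    jumpTime (noiseCons h b) (n + 1) = h.1 + jumpTime b n := by
  simp only [jumpTime, Finset.sum_range_succ', noiseCons]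
  ring

theorem measurable_jumpTime (n : ℕ) : Measurable fun b : Noise => jumpTime b n :=
  Finset.measurable_fun_sum _ fun k _ => measurable_fst.comp (measurable_pi_apply k)

theorem measurable_jumpCount (t : ℝ≥0) : Measurable fun b : Noise => jumpCount b t := by
  classical
  have hm : ∀ n, MeasurableSet {b : Noise | (t : ℝ) < jumpTime b (n + 1)} := fun n =>
    measurableSet_lt measurable_const (measurable_jumpTime _)
  refine measurable_to_countable' fun n => ?_
  have hset : (fun b : Noise => jumpCount b t) ⁻¹' {n}
      = ({b | (t : ℝ) < jumpTime b (n + 1)} ∩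
          ⋂ i : ℕ, ⋂ _ : i < n, {b | (t : ℝ) < jumpTime b (i + 1)}ᶜ) ∪
        ({_b | n = 0} ∩ ⋂ i : ℕ, {b | (t : ℝ) < jumpTime b (i + 1)}ᶜ) := by
    ext b
    simp only [mem_preimage, mem_singleton_iff, mem_union, mem_inter_iff, mem_iInter,
      mem_compl_iff, mem_ofPred_eq]
    by_cases h : ∃ k, (t : ℝ) < jumpTime b (k + 1)
    · have hne : {k | (t : ℝ) < jumpTime b (k + 1)}.Nonempty := h
      refine ⟨?_, fun H => H.elim (fun H => ?_) fun H => absurd h (not_exists.2 H.2)⟩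
      · rintro rfl
        exact Or.inl ⟨Nat.sInf_mem hne, fun i hi => Nat.notMem_of_lt_sInf hi⟩
      · exact le_antisymm (Nat.sInf_le H.1) (not_lt.1 fun hlt => H.2 _ hlt (Nat.sInf_mem hne))
    · have hne : {k | (t : ℝ) < jumpTime b (k + 1)} = ∅ :=
        eq_empty_iff_forall_notMem.2 (not_exists.1 h)
      rw [jumpCount, hne, Nat.sInf_empty]
      refine ⟨fun H => Or.inr ⟨H.symm, not_exists.1 h⟩, fun H => H.elim (fun H => ?_) fun H => ?_⟩
      · exact absurd ⟨n, H.1⟩ h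
      · exact H.1.symm
  rw [hset]
  exact ((hm n).inter (.iInter fun i => .iInter fun _ => (hm i).compl)).union
    ((MeasurableSet.const _).inter (.iInter fun i => (hm i).compl))

variable {X : Type*} {N : ℕ}

section JumpProcess

variable [TopologicalSpace X] (Q : JumpIFS X N)

theorem measurable_flow [SecondCountableTopology X] [MeasurableSpace X] [BorelSpace X] :
    Measurable fun v : ℝ≥0 × X => Q.S v.1 v.2 :=
  Q.S.cont'.measurable

variable [NeZero N]

theorem measurable_jump [MeasurableSpace X] [BorelSpace X] (hw : ∀ i, Continuous (Q.w i))
    (hp : ∀ i, Continuous (Q.p i)) :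
    Measurable fun v : X × ℝ => Q.w (selectIndex (fun i => Q.p i v.1) v.2) v.1 := by
  have hsel : Measurable fun v : X × ℝ => selectIndex (fun i => Q.p i v.1) v.2 :=
    measurable_selectIndex.comp ((measurable_pi_lambda _ fun i =>
      (hp i).measurable.comp measurable_fst).prodMk measurable_snd)
  have hW : Measurable fun v : Fin N × X => Q.w v.1 v.2 :=
    measurable_from_prod_countable_right fun i => (hw i).measurable
  exact hW.comp (hsel.prodMk measurable_fst)

theorem jumpState_noiseCons (x : X) (h : ℝ × ℝ) (b : Noise) (n : ℕ) :
    Q.jumpState x (noiseCons h b) (n + 1)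
      = Q.jumpState (Q.w (selectIndex (fun i => Q.p i (Q.S h.1.toNNReal x)) h.2)
          (Q.S h.1.toNNReal x)) b n := by
  induction n with
  | zero => rfl
  | succ n ih => rw [jumpState, ih]; rfl

theorem process_noiseCons_of_lt (x : X) {t : ℝ≥0} {h : ℝ × ℝ} (b : Noise) (ht : (t : ℝ) < h.1) :
    Q.process x t (noiseCons h b) = Q.S t x := by
  have h0 : jumpCount (noiseCons h b) t = 0 :=
    Nat.sInf_eq_zero.2 <| Or.inl <| by
      rw [mem_ofPred_eq, jumpTime_noiseCons]
      simpa [jumpTime] using ht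
  simp [process, h0, jumpState, jumpTime]

/-- The process starts afresh after the first jump, provided that the number of jumps up to time
`t` is finite. -/
theorem process_noiseCons_of_le (x : X) {t : ℝ≥0} {h : ℝ × ℝ} {b : Noise} (h0 : 0 ≤ h.1)
    (ht : h.1 ≤ t) (hb : ∃ n, ((t - h.1.toNNReal : ℝ≥0) : ℝ) < jumpTime b (n + 1)) :
    Q.process x t (noiseCons h b)
      = Q.process (Q.w (selectIndex (fun i => Q.p i (Q.S h.1.toNNReal x)) h.2)
          (Q.S h.1.toNNReal x)) (t - h.1.toNNReal) b := by
  have hsub : ((t - h.1.toNNReal : ℝ≥0) : ℝ) = t - h.1 := by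
    rw [NNReal.coe_sub (Real.toNNReal_le_iff_le_coe.2 ht), Real.coe_toNNReal _ h0]
  have hcount : jumpCount (noiseCons h b) t = jumpCount b (t - h.1.toNNReal) + 1 := by
    rw [hsub] at hb
    have hmem : ∀ n, (t : ℝ) < jumpTime (noiseCons h b) (n + 1) ↔ t - h.1 < jumpTime b n :=
      fun n => by rw [jumpTime_noiseCons, sub_lt_iff_lt_add']
    unfold jumpCount
    simp only [hmem, hsub]
    refine (Nat.sInf_add (n := 1) (p := fun n => (t : ℝ) - h.1 < jumpTime b n) ?_).symm
    refine le_csInf ?_ fun n hn => Nat.one_le_iff_ne_zero.2 ?_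
    · exact hb.imp' (· + 1) fun n hn => hn
    · rintro rfl
      have : (t : ℝ) - h.1 < 0 := by simpa [jumpTime] using hn
      linarith
  unfold process
  rw [hcount, jumpState_noiseCons, jumpTime_noiseCons, hsub, sub_sub]

variable [SecondCountableTopology X] [MeasurableSpace X] [BorelSpace X]

theorem measurable_jumpState (hw : ∀ i, Continuous (Q.w i)) (hp : ∀ i, Continuous (Q.p i))
    (n : ℕ) : Measurable fun v : X × Noise => Q.jumpState v.1 v.2 n := by
  induction n with
  | zero => exact measurable_fst
  | succ n ih =>
    have hstep : Measurable fun v : X × Noise => v.2 n :=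
      (measurable_pi_apply n).comp measurable_snd
    have hy : Measurable fun v : X × Noise =>
        Q.S (v.2 n).1.toNNReal (Q.jumpState v.1 v.2 n) :=
      Q.measurable_flow.comp (((measurable_fst.comp hstep).real_toNNReal).prodMk ih)
    exact (Q.measurable_jump hw hp).comp (hy.prodMk (measurable_snd.comp hstep))

theorem measurable_process (hw : ∀ i, Continuous (Q.w i)) (hp : ∀ i, Continuous (Q.p i))
    (t : ℝ≥0) : Measurable fun v : X × Noise => Q.process v.1 t v.2 := by
  have hn : ∀ n : ℕ, Measurable fun v : X × Noise =>
      Q.S ((t : ℝ) - jumpTime v.2 n).toNNReal (Q.jumpState v.1 v.2 n) := fun n =>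
    have ht : Measurable fun v : X × Noise => ((t : ℝ) - jumpTime v.2 n).toNNReal :=
      (measurable_const.sub ((measurable_jumpTime n).comp measurable_snd)).real_toNNReal
    Q.measurable_flow.comp (ht.prodMk (Q.measurable_jumpState hw hp n))
  have hc : Measurable fun v : X × Noise => (jumpCount v.2 t, v) :=
    ((measurable_jumpCount t).comp measurable_snd).prodMk measurable_id
  have h : Measurable (Function.uncurry fun (n : ℕ) (v : X × Noise) =>
      Q.S ((t : ℝ) - jumpTime v.2 n).toNNReal (Q.jumpState v.1 v.2 n)) :=
    measurable_from_prod_countable_right hn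
  have hcomp := h.comp hc
  simp only [Function.comp_def, Function.uncurry] at hcomp
  simpa only [process] using hcomp

theorem measurable_process_right (hw : ∀ i, Continuous (Q.w i)) (hp : ∀ i, Continuous (Q.p i))
    (t : ℝ≥0) (x : X) : Measurable (Q.process x t) :=
  have h : Measurable (Function.uncurry fun (x : X) (b : Noise) => Q.process x t b) :=
    Q.measurable_process hw hp t
  h.of_uncurry_left

theorem isProbabilityMeasure_semigroup (hw : ∀ i, Continuous (Q.w i))
    (hp : ∀ i, Continuous (Q.p i)) (t : ℝ≥0) (x : X) :
    IsProbabilityMeasure (Q.semigroup t x) :=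
  have := isProbabilityMeasure_noiseLaw Q.lam_pos
  Measure.isProbabilityMeasure_map (Q.measurable_process_right hw hp t x).aemeasurable

theorem measurable_semigroup (hw : ∀ i, Continuous (Q.w i)) (hp : ∀ i, Continuous (Q.p i))
    (t : ℝ≥0) : Measurable (Q.semigroup t) := by
  have := isProbabilityMeasure_noiseLaw Q.lam_pos
  refine Measure.measurable_of_measurable_coe _ fun B hB => ?_
  have : (fun x => Q.semigroup t x B) = fun x =>
      noiseLaw Q.lam (Prod.mk x ⁻¹' {v : X × Noise | Q.process v.1 t v.2 ∈ B}) := by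
    ext x
    rw [semigroup, Measure.map_apply (Q.measurable_process_right hw hp t x) hB]
    rfl
  rw [this]
  exact measurable_measure_prodMk_left (Q.measurable_process hw hp t hB)

end JumpProcess

/-! ### The renewal equation -/

section Renewal

variable [TopologicalSpace X] [NeZero N] (Q : JumpIFS X N)

/-- The right-hand side of the renewal equation, obtained by conditioning on the first waiting
time `s` and the first index: up to time `t` either no jump has occurred, which contributes
`f (S t x)`, or the first jump occurred at time `s ≤ t`, which contributes the value of `g` at the
remaining time `t - s` and the position after the jump. -/
noncomputable def renewal (f : X → ℝ≥0∞) (g : ℝ≥0 → X → ℝ≥0∞) (t : ℝ≥0) (x : X) : ℝ≥0∞ :=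
  ∫⁻ s, if (t : ℝ) < s then f (Q.S t x) else
    (∫⁻ u in Icc (0 : ℝ) 1, g (t - s.toNNReal)
      (Q.w (selectIndex (fun i => Q.p i (Q.S s.toNNReal x)) u) (Q.S s.toNNReal x)))
    ∂expMeasure Q.lam

/-- The comparison principle: up to time `T` the renewal operator contracts differences by the
factor `expMeasure (Iic T) < 1`, the probability of a jump before `T`. -/
theorem le_of_le_renewal_of_renewal_le {f : X → ℝ≥0∞} {g h : ℝ≥0 → X → ℝ≥0∞} {B : ℝ≥0∞}
    (hB : B ≠ ∞) (hgB : ∀ t x, g t x ≤ B) (hg : ∀ t x, g t x ≤ Q.renewal f g t x)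
    (hh : ∀ t x, Q.renewal f h t x ≤ h t x) (T : ℝ≥0) (x : X) : g T x ≤ h T x := by
  have := isProbabilityMeasure_expMeasure Q.lam_pos
  set c : ℝ≥0∞ := expMeasure Q.lam (Iic (T : ℝ)) with hc
  have hc1 : c < 1 := by
    rw [hc, expMeasure_Iic Q.lam_pos T.coe_nonneg, ENNReal.ofReal_lt_one]
    have := Real.exp_pos (-(Q.lam * T))
    linarith
  have hn : ∀ n : ℕ, ∀ t ≤ T, ∀ x, g t x ≤ h t x + c ^ n * B := by
    intro n
    induction n with
    | zero => intro t _ x; simpa using (hgB t x).trans le_add_self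
    | succ n ih =>
      intro t ht x
      calc g t x ≤ Q.renewal f g t x := hg t x
        _ ≤ ∫⁻ s, ((if (t : ℝ) < s then f (Q.S t x) else
              (∫⁻ u in Icc (0 : ℝ) 1, h (t - s.toNNReal)
                (Q.w (selectIndex (fun i => Q.p i (Q.S s.toNNReal x)) u) (Q.S s.toNNReal x))))
              + (Iic (T : ℝ)).indicator (fun _ => c ^ n * B) s) ∂expMeasure Q.lam := by
            refine lintegral_mono fun s => ?_
            dsimp only
            split_ifs with hs
            · exact le_self_add
            · have hsT : s ∈ Iic (T : ℝ) := (not_lt.1 hs).trans (NNReal.coe_le_coe.2 ht)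
              rw [indicator_of_mem hsT]
              refine (lintegral_mono fun u => ih _ (tsub_le_self.trans ht) _).trans_eq ?_
              rw [lintegral_add_right _ measurable_const]
              simp
        _ = Q.renewal f h t x + c ^ n * B * c := by
            rw [lintegral_add_right _ (measurable_const.indicator measurableSet_Iic),
              lintegral_indicator_const measurableSet_Iic]
            rfl
        _ ≤ h t x + c ^ (n + 1) * B := by
            rw [pow_succ, mul_right_comm]
            exact add_le_add_left (hh t x) _
  have hlim : Tendsto (fun n : ℕ => h T x + c ^ n * B) atTop (𝓝 (h T x + 0 * B)) :=
    tendsto_const_nhds.add (ENNReal.Tendsto.mul_const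
      (ENNReal.tendsto_pow_atTop_nhds_zero_of_lt_one hc1) (Or.inr hB))
  have := ge_of_tendsto' hlim fun n => hn n T le_rfl x
  simpa using this

/-- Almost surely there are only finitely many jumps up to time `t`: the probability of the
contrary, as a function of `t`, is a subsolution of the renewal equation with `f = 0`. -/
theorem ae_exists_lt_jumpTime [Nonempty X] (t : ℝ≥0) :
    ∀ᵐ b ∂noiseLaw Q.lam, ∃ n, (t : ℝ) < jumpTime b (n + 1) := by
  have := isProbabilityMeasure_noiseLaw Q.lam_pos
  have := isProbabilityMeasure_expMeasure Q.lam_pos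
  obtain ⟨x⟩ := ‹Nonempty X›
  -- the event that there are infinitely many jumps up to time `t`
  set E : ℝ≥0 → Set Noise := fun t => {b | ∀ n, jumpTime b (n + 1) ≤ t} with hE
  have hEm : ∀ t, MeasurableSet (E t) := fun t => by
    rw [hE]
    simp only [ofPred_forall]
    exact .iInter fun n => measurableSet_le (measurable_jumpTime _) measurable_const
  have hle : noiseLaw Q.lam (E t) ≤ 0 := by
    refine Q.le_of_le_renewal_of_renewal_le (f := fun _ => 0)
      (g := fun t _ => noiseLaw Q.lam (E t)) (h := fun _ _ => 0) ENNReal.one_ne_top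
      (fun _ _ => prob_le_one) (fun t x => ?_) (fun t x => by simp [renewal]) t x
    rw [← lintegral_indicator_one (hEm t),
      lintegral_noiseLaw Q.lam_pos (measurable_one.indicator (hEm t)), renewal]
    refine lintegral_mono_ae ?_
    filter_upwards [ae_nonneg_expMeasure Q.lam_pos] with s hs0
    split_ifs with hs
    · have hzero : ∀ u b, (E t).indicator (1 : Noise → ℝ≥0∞) (noiseCons (s, u) b) = 0 := by
        intro u b
        refine indicator_of_notMem (fun hb => ?_) _
        have := hb 0
        rw [jumpTime_noiseCons, jumpTime, Finset.sum_range_zero, add_zero] at this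
        exact absurd hs (not_lt.2 this)
      simp [hzero]
    · refine lintegral_mono fun u => ?_
      rw [← lintegral_indicator_one (hEm _)]
      refine lintegral_mono fun b => ?_
      by_cases hb : noiseCons (s, u) b ∈ E t
      · have hb' : b ∈ E (t - s.toNNReal) := fun n => by
          have := hb (n + 1)
          rw [jumpTime_noiseCons] at this
          rw [NNReal.coe_sub (Real.toNNReal_le_iff_le_coe.2 (not_lt.1 hs)),
            Real.coe_toNNReal _ hs0]
          linarith
        rw [indicator_of_mem hb, indicator_of_mem hb']
        exact le_rfl
      · rw [indicator_of_notMem hb]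
        exact zero_le
  filter_upwards [measure_eq_zero_iff_ae_notMem.1 (le_antisymm hle zero_le)] with b hb
  by_contra! hcon
  exact hb hcon

variable [SecondCountableTopology X] [MeasurableSpace X] [BorelSpace X]

/-- The renewal equation for `P_t f`. -/
theorem lintegral_semigroup_eq_renewal (hw : ∀ i, Continuous (Q.w i))
    (hp : ∀ i, Continuous (Q.p i)) {f : X → ℝ≥0∞} (hf : Measurable f) (t : ℝ≥0) (x : X) :
    ∫⁻ y, f y ∂Q.semigroup t x = Q.renewal f (fun t x => ∫⁻ y, f y ∂Q.semigroup t x) t x := by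
  have := isProbabilityMeasure_noiseLaw Q.lam_pos
  have : Nonempty X := ⟨x⟩
  have hmap : ∀ t x, ∫⁻ y, f y ∂Q.semigroup t x
      = ∫⁻ b, f (Q.process x t b) ∂noiseLaw Q.lam := fun t x =>
    lintegral_map hf (Q.measurable_process_right hw hp t x)
  simp only [hmap]
  have hfm : Measurable fun b => f (Q.process x t b) :=
    hf.comp (Q.measurable_process_right hw hp t x)
  rw [lintegral_noiseLaw Q.lam_pos hfm, renewal]
  refine lintegral_congr_ae ?_
  filter_upwards [ae_nonneg_expMeasure Q.lam_pos] with s hs0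
  split_ifs with hs
  · have hconst : ∀ u b, f (Q.process x t (noiseCons (s, u) b)) = f (Q.S t x) := fun u b => by
      rw [Q.process_noiseCons_of_lt x (h := (s, u)) b hs]
    simp [hconst]
  · refine lintegral_congr fun u => lintegral_congr_ae ?_
    filter_upwards [Q.ae_exists_lt_jumpTime (t - s.toNNReal)] with b hb
    rw [Q.process_noiseCons_of_le x hs0 (not_lt.1 hs) hb]

/-- The Chapman–Kolmogorov equation. By the memoryless property of the exponential law both sides,
as functions of `t`, solve the same renewal equation. -/
theorem lintegral_semigroup_add (hw : ∀ i, Continuous (Q.w i)) (hp : ∀ i, Continuous (Q.p i))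
    {f : X → ℝ≥0∞} (hf : Measurable f) {B : ℝ≥0∞} (hB : B ≠ ∞) (hfB : ∀ x, f x ≤ B)
    (t s : ℝ≥0) (x : X) :
    ∫⁻ y, f y ∂Q.semigroup (t + s) x = ∫⁻ y, ∫⁻ y', f y' ∂Q.semigroup s y ∂Q.semigroup t x := by
  have hbound : ∀ (g : X → ℝ≥0∞), (∀ x, g x ≤ B) → ∀ t x, ∫⁻ y, g y ∂Q.semigroup t x ≤ B := by
    intro g hg t x
    have := Q.isProbabilityMeasure_semigroup hw hp t x
    exact (lintegral_mono hg).trans_eq (by simp)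
  have hmeas : Measurable fun y => ∫⁻ y', f y' ∂Q.semigroup s y :=
    (Measure.measurable_lintegral hf).comp (Q.measurable_semigroup hw hp s)
  -- the left-hand side solves the equation of the right-hand side: first jumps after time `t` are
  -- shifted by `t`
  have hleft : ∀ t x, ∫⁻ y, f y ∂Q.semigroup (t + s) x
      = Q.renewal (fun y => ∫⁻ y', f y' ∂Q.semigroup s y)
        (fun t x => ∫⁻ y, f y ∂Q.semigroup (t + s) x) t x := by
    intro t x
    have hsplit := fun G : ℝ → ℝ≥0∞ => lintegral_add_compl (μ := expMeasure Q.lam) G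
      (measurableSet_Iic (a := (t : ℝ)))
    simp only [compl_Iic] at hsplit
    rw [Q.lintegral_semigroup_eq_renewal hw hp hf, renewal, renewal, ← hsplit, ← hsplit]
    congr 1
    · refine setLIntegral_congr_fun measurableSet_Iic fun σ hσ => ?_
      have hσ' : σ ≤ t := hσ
      have h1 : ¬ ((t + s : ℝ≥0) : ℝ) < σ := by
        rw [not_lt, NNReal.coe_add]
        exact hσ'.trans (le_add_of_nonneg_right s.coe_nonneg)
      have h2 : t + s - σ.toNNReal = t - σ.toNNReal + s :=
        tsub_add_eq_add_tsub (Real.toNNReal_le_iff_le_coe.2 hσ') |>.symm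
      simp only [h1, not_lt.2 hσ', if_false, h2]
    · rw [setLIntegral_Ioi_expMeasure Q.lam_pos t.coe_nonneg]
      have h1 : ∫⁻ σ in Ioi (t : ℝ), (if (t : ℝ) < σ then
          (∫⁻ y', f y' ∂Q.semigroup s (Q.S t x)) else
          (∫⁻ u in Icc (0 : ℝ) 1, ∫⁻ y, f y ∂Q.semigroup (t - σ.toNNReal + s)
            (Q.w (selectIndex (fun i => Q.p i (Q.S σ.toNNReal x)) u) (Q.S σ.toNNReal x))))
          ∂expMeasure Q.lam
          = ∫⁻ σ in Ioi (t : ℝ), (∫⁻ y', f y' ∂Q.semigroup s (Q.S t x)) ∂expMeasure Q.lam :=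
        setLIntegral_congr_fun measurableSet_Ioi fun σ hσ => by
          have hσ' : (t : ℝ) < σ := hσ
          simp only [hσ', if_true]
      rw [h1, setLIntegral_const, mul_comm]
      congr 1
      rw [Q.lintegral_semigroup_eq_renewal hw hp hf, renewal]
      refine lintegral_congr_ae ?_
      filter_upwards [ae_nonneg_expMeasure Q.lam_pos] with σ hσ
      have e1 : ((t : ℝ) + σ).toNNReal = σ.toNNReal + t := by
        rw [Real.toNNReal_add t.coe_nonneg hσ, Real.toNNReal_coe, add_comm]
      have e2 : t + s - (σ.toNNReal + t) = s - σ.toNNReal := by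
        rw [add_comm t s, add_tsub_add_eq_tsub_right]
      have e3 : Q.S (t + s) x = Q.S s (Q.S t x) := by rw [add_comm, Q.S.map_add]
      simp only [e1, e2, e3, Q.S.map_add, NNReal.coe_add, add_lt_add_iff_left]
  refine le_antisymm ?_ ?_
  · exact Q.le_of_le_renewal_of_renewal_le
      (g := fun t x => ∫⁻ y, f y ∂Q.semigroup (t + s) x)
      (h := fun t x => ∫⁻ y, ∫⁻ y', f y' ∂Q.semigroup s y ∂Q.semigroup t x) hB
      (fun t x => hbound f hfB _ x) (fun t x => (hleft t x).le)
      (fun t x => (Q.lintegral_semigroup_eq_renewal hw hp hmeas t x).ge) t x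
  · exact Q.le_of_le_renewal_of_renewal_le
      (g := fun t x => ∫⁻ y, ∫⁻ y', f y' ∂Q.semigroup s y ∂Q.semigroup t x)
      (h := fun t x => ∫⁻ y, f y ∂Q.semigroup (t + s) x) hB
      (fun t x => hbound _ (hbound f hfB s) t x)
      (fun t x => (Q.lintegral_semigroup_eq_renewal hw hp hmeas t x).le)
      (fun t x => (hleft t x).ge) t x

end Renewal

end JumpIFS

/-! ### A Lyapunov function -/

theorem setLIntegral_selectIndex {N : ℕ} [NeZero N] {q : Fin N → ℝ} (hq : ∀ k, 0 ≤ q k)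
    (hq1 : ∑ k, q k = 1) {g : Fin N → ℝ} (hg : ∀ k, 0 ≤ g k) :
    ∫⁻ u in Icc (0 : ℝ) 1, ENNReal.ofReal (g (selectIndex q u))
      = ENNReal.ofReal (∑ k, q k * g k) := by
  have hm : Measurable (selectIndex q) := measurable_selectIndex.comp measurable_prodMk_left
  have h := lintegral_map (μ := (volume : Measure ℝ).restrict (Icc (0 : ℝ) 1))
    (f := fun k => ENNReal.ofReal (g k)) (measurable_of_countable _) hm
  rw [← h, lintegral_fintype, ENNReal.ofReal_sum_of_nonneg fun k _ => mul_nonneg (hq k) (hg k)]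
  refine Finset.sum_congr rfl fun k _ => ?_
  rw [Measure.map_apply hm (measurableSet_singleton k), ENNReal.ofReal_mul (hq k), mul_comm,
    ← volume_selectIndex q hq hq1 k]
  rfl

/-- The product of the density `l * exp (-l s)` and the growing function `(θ / l) * exp (a s)` is
again an exponential density, of rate `θ = l - a`. -/
theorem setLIntegral_Iic_exp_expMeasure {l a v t : ℝ} (hl : 0 < l) (hal : a < l) (hv : 0 ≤ v) :
    ∫⁻ s in Iic t, ENNReal.ofReal ((l - a) / l * (Real.exp (a * s) * v)) ∂expMeasure l
      = ENNReal.ofReal v * expMeasure (l - a) (Iic t) := by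
  have hdens : ∀ l : ℝ, expMeasure l = volume.withDensity (exponentialPDF l) := fun _ => rfl
  have hmeas : ∀ l : ℝ, Measurable (exponentialPDF l) := fun l =>
    (measurable_exponentialPDFReal l).ennreal_ofReal
  rw [hdens, setLIntegral_withDensity_eq_setLIntegral_mul _ (hmeas l) (by fun_prop)
    measurableSet_Iic, hdens, withDensity_apply _ measurableSet_Iic,
    ← lintegral_const_mul _ (hmeas _)]
  refine lintegral_congr fun s => ?_
  rw [Pi.mul_apply]
  rcases lt_or_ge s 0 with hs | hs
  · rw [exponentialPDF_of_neg hs, exponentialPDF_of_neg hs, zero_mul, mul_zero]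
  · have := sub_pos.2 hal
    rw [exponentialPDF_of_nonneg hs, exponentialPDF_of_nonneg hs,
      ← ENNReal.ofReal_mul (by positivity), ← ENNReal.ofReal_mul hv]
    have : Real.exp (-((l - a) * s)) = Real.exp (-(l * s)) * Real.exp (a * s) := by
      rw [← Real.exp_add]; ring_nf
    rw [this]
    congr 1
    field_simp

/-- The Lyapunov function `min (√(dist x z)) b`. The truncation at `b` makes it bounded and confines
the contraction needed of it to a neighbourhood of `z`. -/
noncomputable def potential {X : Type*} [MetricSpace X] (z : X) (b : ℝ) (x : X) : ℝ :=
  min √(dist x z) b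

namespace JumpIFS

variable {X : Type*} [MetricSpace X] {N : ℕ} (Q : JumpIFS X N) {z : X} {r : X → ℝ} {α : ℝ}

theorem sum_p_mul_sqrt_dist_le
    (hcontr : ∀ x, ∑ i, Q.p i x * dist (Q.w i x) z ≤ r x * dist x z) {q : ℝ} (hq : 0 ≤ q) (x : X)
    (hx : x ≠ z → r x ≤ q ^ 2) :
    ∑ i, Q.p i x * √(dist (Q.w i x) z) ≤ q * √(dist x z) := by
  -- Cauchy–Schwarz for the vectors `√p` and `√(p * dist)`
  calc ∑ i, Q.p i x * √(dist (Q.w i x) z)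
      = ∑ i, √(Q.p i x) * √(Q.p i x * dist (Q.w i x) z) := by
        refine Finset.sum_congr rfl fun i _ => ?_
        rw [Real.sqrt_mul (Q.p_nonneg i x), ← mul_assoc, Real.mul_self_sqrt (Q.p_nonneg i x)]
    _ ≤ √(∑ i, Q.p i x) * √(∑ i, Q.p i x * dist (Q.w i x) z) :=
        Real.sum_sqrt_mul_sqrt_le _ (fun i => Q.p_nonneg i x)
          fun i => mul_nonneg (Q.p_nonneg i x) dist_nonneg
    _ = √(∑ i, Q.p i x * dist (Q.w i x) z) := by rw [Q.p_sum, Real.sqrt_one, one_mul]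
    _ ≤ √(q ^ 2 * dist x z) := by
        refine Real.sqrt_le_sqrt ((hcontr x).trans ?_)
        by_cases hxz : x = z
        · simp [hxz]
        · exact mul_le_mul_of_nonneg_right (hx hxz) dist_nonneg
    _ = q * √(dist x z) := by rw [Real.sqrt_mul (sq_nonneg q), Real.sqrt_sq hq]

variable [NeZero N]

/-- The one-jump inequality: the potential does not grow in mean up to the first jump or the time
`t`, whichever comes first. While the bound `exp (α s / 2) * √(dist x z)` along the flow is below
`b`, the contraction at the jump compensates for the growth exactly; once it has reached `b`, the
trivial bound `b` preserves the balance. -/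
theorem renewal_potential_le (hα : 0 ≤ α) (hα_lt : α < Q.lam)
    (hcontr : ∀ x, ∑ i, Q.p i x * dist (Q.w i x) z ≤ r x * dist x z)
    (hS : ∀ (t : ℝ≥0) (x y : X), dist (Q.S t x) (Q.S t y) ≤ Real.exp (α * t) * dist x y)
    (hz : ∀ t : ℝ≥0, Q.S t z = z) {b : ℝ} (hb : 0 < b)
    (hloc : ∀ x, dist x z ≤ b ^ 2 → x ≠ z → r x ≤ ((Q.lam - α / 2) / Q.lam) ^ 2)
    (t : ℝ≥0) (x : X) :
    Q.renewal (fun x => ENNReal.ofReal (potential z b x))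
      (fun _ x => ENNReal.ofReal (potential z b x)) t x ≤ ENNReal.ofReal (potential z b x) := by
  have hprob := isProbabilityMeasure_expMeasure Q.lam_pos
  have hlam := Q.lam_pos
  have hpot0 : ∀ x, 0 ≤ potential z b x := fun x => le_min (Real.sqrt_nonneg _) hb.le
  have hpotb : ∀ x, potential z b x ≤ b := fun x => min_le_right _ _
  set v : ℝ := √(dist x z) with hv
  have hv0 : 0 ≤ v := Real.sqrt_nonneg _
  have hflow : ∀ s : ℝ≥0, √(dist (Q.S s x) z) ≤ Real.exp (α / 2 * s) * v := fun s => by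
    have h := hS s x z
    rw [hz] at h
    refine (Real.sqrt_le_sqrt h).trans_eq ?_
    rw [Real.sqrt_mul (Real.exp_nonneg _), ← Real.exp_half, hv]
    ring_nf
  have hjump : ∀ y, ∫⁻ u in Icc (0 : ℝ) 1,
      ENNReal.ofReal (potential z b (Q.w (selectIndex (fun i => Q.p i y) u) y))
      = ENNReal.ofReal (∑ i, Q.p i y * potential z b (Q.w i y)) := fun y =>
    setLIntegral_selectIndex (g := fun i => potential z b (Q.w i y)) (fun i => Q.p_nonneg i y)
      (Q.p_sum y) fun i => hpot0 _
  have hjumpb : ∀ y, ∑ i, Q.p i y * potential z b (Q.w i y) ≤ b := fun y => by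
    calc _ ≤ ∑ i, Q.p i y * b :=
          Finset.sum_le_sum fun i _ => mul_le_mul_of_nonneg_left (hpotb _) (Q.p_nonneg i y)
      _ = b := by rw [← Finset.sum_mul, Q.p_sum, one_mul]
  have hjumpq : ∀ y, √(dist y z) ≤ b → ∑ i, Q.p i y * potential z b (Q.w i y)
      ≤ (Q.lam - α / 2) / Q.lam * √(dist y z) := fun y hy => by
    refine le_trans (Finset.sum_le_sum fun i _ =>
      mul_le_mul_of_nonneg_left (min_le_left _ _) (Q.p_nonneg i y)) ?_
    exact Q.sum_p_mul_sqrt_dist_le hcontr (div_nonneg (by linarith) hlam.le) y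
      (hloc y ((Real.sqrt_le_left hb.le).1 hy))
  rw [renewal]
  simp only [hjump]
  rcases le_or_gt b v with hbv | hvb
  · rw [show potential z b x = b from min_eq_right hbv]
    refine (lintegral_mono (g := fun _ => ENNReal.ofReal b) fun s => ?_).trans_eq (by simp)
    dsimp only
    split_ifs
    exacts [ENNReal.ofReal_le_ofReal (hpotb _), ENNReal.ofReal_le_ofReal (hjumpb _)]
  rw [show potential z b x = v from min_eq_left hvb.le]
  -- the time `t₀ ≤ t` until which the bound along the flow is below `b`
  obtain ⟨t₀, ht₀, ht₀t, hle, hor⟩ : ∃ t₀ : ℝ, 0 ≤ t₀ ∧ t₀ ≤ t ∧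
      Real.exp (α / 2 * t₀) * v ≤ b ∧ (t₀ = t ∨ Real.exp (α / 2 * t₀) * v = b) := by
    rcases le_or_gt (Real.exp (α / 2 * t) * v) b with h | h
    · exact ⟨t, t.coe_nonneg, le_rfl, h, Or.inl rfl⟩
    · have hcont : ContinuousOn (fun s : ℝ => Real.exp (α / 2 * s) * v) (Icc 0 t) := by fun_prop
      obtain ⟨t₀, ht₀, he⟩ := intermediate_value_Icc t.coe_nonneg hcont
        ⟨by simpa using hvb.le, h.le⟩
      exact ⟨t₀, ht₀.1, ht₀.2, he.le, Or.inr he⟩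
  have hal : α / 2 < Q.lam := by linarith
  calc _ ≤ ∫⁻ s, (Iic t₀).indicator (fun s => ENNReal.ofReal
            ((Q.lam - α / 2) / Q.lam * (Real.exp (α / 2 * s) * v))) s +
          (Ioi t₀).indicator (fun _ => ENNReal.ofReal (Real.exp (α / 2 * t₀) * v)) s
          ∂expMeasure Q.lam := by
        refine lintegral_mono_ae ?_
        filter_upwards [ae_nonneg_expMeasure Q.lam_pos] with s hs0
        rcases le_or_gt s t₀ with hs | hs
        · rw [indicator_of_mem (mem_Iic.2 hs), indicator_of_notMem (by simpa using hs), add_zero,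
            if_neg (not_lt.2 (hs.trans ht₀t))]
          refine ENNReal.ofReal_le_ofReal ?_
          have h1 := hflow s.toNNReal
          rw [Real.coe_toNNReal _ hs0] at h1
          have h2 : Real.exp (α / 2 * s) * v ≤ b := le_trans (by gcongr) hle
          exact (hjumpq _ (h1.trans h2)).trans
            (mul_le_mul_of_nonneg_left h1 (div_nonneg (by linarith) hlam.le))
        · rw [indicator_of_notMem (by simpa using hs), indicator_of_mem (mem_Ioi.2 hs), zero_add]
          rcases hor with rfl | hor
          · rw [if_pos hs]
            exact ENNReal.ofReal_le_ofReal ((min_le_left _ _).trans (hflow t))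
          · rw [hor]
            split_ifs
            exacts [ENNReal.ofReal_le_ofReal (hpotb _), ENNReal.ofReal_le_ofReal (hjumpb _)]
    _ = ENNReal.ofReal v * expMeasure (Q.lam - α / 2) (Iic t₀)
          + ENNReal.ofReal (Real.exp (α / 2 * t₀) * v) * expMeasure Q.lam (Ioi t₀) := by
        rw [lintegral_add_right _ (measurable_const.indicator measurableSet_Ioi),
          lintegral_indicator measurableSet_Iic, lintegral_indicator_const measurableSet_Ioi,
          setLIntegral_Iic_exp_expMeasure hlam hal hv0]
    _ = ENNReal.ofReal v := by
        have hexp : Real.exp (-((Q.lam - α / 2) * t₀)) ≤ 1 := by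
          rw [Real.exp_le_one_iff, neg_nonpos]
          exact mul_nonneg (by linarith) ht₀
        rw [expMeasure_Iic (sub_pos.2 hal) ht₀, expMeasure_Ioi hlam ht₀,
          ← ENNReal.ofReal_mul hv0, ← ENNReal.ofReal_mul (by positivity),
          ← ENNReal.ofReal_add (mul_nonneg hv0 (sub_nonneg.2 hexp)) (by positivity)]
        congr 1
        have : Real.exp (-((Q.lam - α / 2) * t₀))
            = Real.exp (α / 2 * t₀) * Real.exp (-(Q.lam * t₀)) := by
          rw [← Real.exp_add]; ring_nf
        rw [this]
        ring

end JumpIFS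

/-! ### Decay along a Markov semigroup -/

/-- If `φ` is a bounded excessive function which is small near `z`, and every neighbourhood of `z`
is reached with a probability bounded from below, then `P_t φ` decreases to `0`. Indeed the limit
`L` satisfies `L ≤ P_t L`, so its supremum `κ` would satisfy `κ ≤ κ - (κ / 2) * β` if it were
positive. -/
theorem tendsto_lintegral_zero_of_excessive {X : Type*} [PseudoMetricSpace X] [MeasurableSpace X]
    [OpensMeasurableSpace X] {P : ℝ≥0 → X → Measure X} [∀ t x, IsProbabilityMeasure (P t x)]
    (hP : ∀ t, Measurable (P t)) {φ : X → ℝ≥0∞} (hφ : Measurable φ) {B : ℝ≥0∞} (hB : B ≠ ∞)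
    (hφB : ∀ x, φ x ≤ B)
    (hadd : ∀ t s x, ∫⁻ y, φ y ∂P (t + s) x = ∫⁻ y, ∫⁻ y', φ y' ∂P s y ∂P t x)
    (hexc : ∀ t x, ∫⁻ y, φ y ∂P t x ≤ φ x) {z : X}
    (hsmall : ∀ δ > 0, ∃ ε > (0 : ℝ), ∀ x ∈ Metric.ball z ε, φ x ≤ δ)
    (hreach : ∀ ε > (0 : ℝ), ∃ β > (0 : ℝ), ∀ x : X, ∃ t : ℝ≥0,
      β < (P t x).real (Metric.ball z ε)) (x : X) :
    Tendsto (fun t : ℝ≥0 => ∫⁻ y, φ y ∂P t x) atTop (𝓝 0) := by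
  have hanti : ∀ x, Antitone fun t : ℝ≥0 => ∫⁻ y, φ y ∂P t x := by
    intro x t s hts
    obtain ⟨c, rfl⟩ := exists_add_of_le hts
    exact (hadd t c x).trans_le (lintegral_mono fun y => hexc c y)
  have hmeas : ∀ t, Measurable fun x => ∫⁻ y, φ y ∂P t x := fun t =>
    (Measure.measurable_lintegral hφ).comp (hP t)
  set L : X → ℝ≥0∞ := fun x => ⨅ n : ℕ, ∫⁻ y, φ y ∂P n x with hL
  have hLφ : ∀ x, L x ≤ φ x := fun x => (iInf_le _ 0).trans (hexc _ x)
  have hLP : ∀ t x, L x ≤ ∫⁻ y, L y ∂P t x := by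
    intro t x
    rw [hL, lintegral_iInf (fun n => hmeas n)
      (fun m n hmn y => hanti y (Nat.cast_le.2 hmn))
      (((lintegral_mono fun y => (hexc _ y).trans (hφB y)).trans_lt
        (by simpa using hB.lt_top)).ne)]
    refine le_iInf fun n => ?_
    rw [← hadd]
    obtain ⟨k, hk⟩ := exists_nat_ge (t + n)
    exact (iInf_le _ k).trans (hanti x hk)
  set κ : ℝ≥0∞ := ⨆ x, L x with hκ
  have hκB : κ ≠ ∞ := ne_top_of_le_ne_top hB (iSup_le fun x => (hLφ x).trans (hφB x))
  have hκ0 : κ = 0 := by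
    by_contra hne
    have hhalf : κ / 2 ≠ 0 := by simpa using hne
    obtain ⟨ε, hε, hball⟩ := hsmall (κ / 2) (pos_iff_ne_zero.2 hhalf)
    obtain ⟨β, hβ, hreach⟩ := hreach ε hε
    have hstep : ∀ x, L x + κ / 2 * ENNReal.ofReal β ≤ κ := by
      intro x
      obtain ⟨t, ht⟩ := hreach x
      have hbm : MeasurableSet (Metric.ball z ε) := Metric.isOpen_ball.measurableSet
      have hβp : ENNReal.ofReal β ≤ P t x (Metric.ball z ε) :=
        ENNReal.ofReal_le_of_le_toReal ht.le
      have hLle : L x ≤ κ / 2 * P t x (Metric.ball z ε) + κ * P t x (Metric.ball z ε)ᶜ := by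
        refine (hLP t x).trans ?_
        rw [← lintegral_add_compl _ hbm, ← setLIntegral_const, ← setLIntegral_const]
        refine add_le_add (setLIntegral_mono measurable_const fun y hy => ?_)
          (setLIntegral_mono measurable_const fun y _ => le_iSup L y)
        exact (hLφ y).trans (hball y hy)
      calc L x + κ / 2 * ENNReal.ofReal β
          ≤ κ / 2 * P t x (Metric.ball z ε) + κ * P t x (Metric.ball z ε)ᶜ
            + κ / 2 * P t x (Metric.ball z ε) := by gcongr
        _ = (κ / 2 + κ / 2) * P t x (Metric.ball z ε) + κ * P t x (Metric.ball z ε)ᶜ := by ring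
        _ = κ := by
            rw [ENNReal.add_halves, ← mul_add, measure_add_measure_compl hbm, measure_univ,
              mul_one]
    have hc : κ / 2 * ENNReal.ofReal β ≠ 0 :=
      mul_ne_zero hhalf (by simpa using hβ)
    have hlt : κ - κ / 2 * ENNReal.ofReal β < κ := ENNReal.sub_lt_self hκB hne hc
    have hcfin : κ / 2 * ENNReal.ofReal β ≠ ∞ := by finiteness
    exact absurd (iSup_le fun x => ENNReal.le_sub_of_add_le_right hcfin (hstep x)) (not_le.2 hlt)
  have hLx : L x = 0 := le_antisymm ((le_iSup L x).trans hκ0.le) zero_le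
  refine ENNReal.tendsto_nhds_zero.2 fun ε hε => ?_
  obtain ⟨n, hn⟩ := iInf_lt_iff.1 (hLx.trans_lt hε)
  filter_upwards [eventually_ge_atTop (n : ℝ≥0)] with t ht
  exact (hanti x ht).trans hn.le

/-! ### Weak convergence to a point mass -/

theorem tendsto_integral_of_tendsto_lintegral_potential {X ι : Type*} [MetricSpace X]
    [MeasurableSpace X] [OpensMeasurableSpace X] {l : Filter ι}
    {μ : ι → Measure X} [∀ i, IsProbabilityMeasure (μ i)] {z : X} {b : ℝ} (hb : 0 < b)
    (hμ : Tendsto (fun i => ∫⁻ x, ENNReal.ofReal (potential z b x) ∂μ i) l (𝓝 0))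
    (f : X →ᵇ ℝ) : Tendsto (fun i => ∫ x, f x ∂μ i) l (𝓝 (f z)) := by
  have hcont : Continuous (potential z b) := by unfold potential; fun_prop
  have hpot0 : ∀ x, 0 ≤ potential z b x := fun x => le_min (Real.sqrt_nonneg _) hb.le
  have hint : ∀ i, Integrable (potential z b) (μ i) := fun i =>
    Integrable.of_bound hcont.aestronglyMeasurable b (Eventually.of_forall fun x => by
      rw [Real.norm_of_nonneg (hpot0 x)]; exact min_le_right _ _)
  have hμ' : Tendsto (fun i => ∫ x, potential z b x ∂μ i) l (𝓝 0) := by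
    have := (ENNReal.tendsto_toReal ENNReal.zero_ne_top).comp hμ
    refine this.congr fun i => ?_
    rw [integral_eq_lintegral_of_nonneg_ae (Eventually.of_forall hpot0)
      hcont.aestronglyMeasurable]
    rfl
  rw [Metric.tendsto_nhds]
  intro ε hε
  obtain ⟨u, hu, hball⟩ := Metric.continuousAt_iff.1
    (f.continuous.continuousAt (x := z)) (ε / 2) (half_pos hε)
  set m : ℝ := min √u b with hm
  have hm0 : 0 < m := lt_min (Real.sqrt_pos.2 hu) hb
  set C : ℝ := 2 * ‖f‖ / m with hC
  have hC0 : 0 ≤ C := by positivity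
  have hbound : ∀ x, |f x - f z| ≤ ε / 2 + C * potential z b x := by
    intro x
    rcases lt_or_ge (dist x z) u with hx | hx
    · have := hball hx
      rw [Real.dist_eq] at this
      have := mul_nonneg hC0 (hpot0 x)
      linarith
    · have h1 : m ≤ potential z b x := min_le_min_right _ (Real.sqrt_le_sqrt hx)
      have h2 : |f x - f z| ≤ 2 * ‖f‖ := by
        rw [← Real.dist_eq]; exact f.dist_le_two_norm x z
      have h3 : 2 * ‖f‖ = C * m := by rw [hC]; field_simp
      have h4 := mul_le_mul_of_nonneg_left h1 hC0
      linarith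
  have hev : ∀ᶠ i in l, C * ∫ x, potential z b x ∂μ i < ε / 2 := by
    have : Tendsto (fun i => C * ∫ x, potential z b x ∂μ i) l (𝓝 (C * 0)) := hμ'.const_mul C
    rw [mul_zero] at this
    exact this.eventually (gt_mem_nhds (half_pos hε))
  filter_upwards [hev] with i hi
  have hfi : Integrable f (μ i) := f.integrable (μ i)
  calc dist (∫ x, f x ∂μ i) (f z) = |∫ x, (f x - f z) ∂μ i| := by
        rw [integral_sub hfi (integrable_const _), Real.dist_eq]; simp
    _ ≤ ∫ x, |f x - f z| ∂μ i := abs_integral_le_integral_abs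
    _ ≤ ∫ x, (ε / 2 + C * potential z b x) ∂μ i :=
        integral_mono (hfi.sub (integrable_const _)).abs
          ((integrable_const _).add ((hint i).const_mul C)) hbound
    _ = ε / 2 + C * ∫ x, potential z b x ∂μ i := by
        rw [integral_add (integrable_const _) ((hint i).const_mul C), integral_const_mul]; simp
    _ < ε := by linarith

/-- A Markov family for which the mean potential tends to zero from every starting point, and is
zero from `z`, is asymptotically stable, with the point mass at `z` as its invariant measure. -/
theorem asymptoticallyStable_of_tendsto_potential {X : Type*} [MetricSpace X] [MeasurableSpace X]
    [BorelSpace X] {P : ℝ≥0 → X → Measure X} [∀ t x, IsProbabilityMeasure (P t x)]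
    (hP : ∀ t, Measurable (P t)) {z : X} {b : ℝ} (hb : 0 < b)
    (hz : ∀ t, ∫⁻ y, ENNReal.ofReal (potential z b y) ∂P t z = 0)
    (hlim : ∀ x, Tendsto (fun t : ℝ≥0 => ∫⁻ y, ENNReal.ofReal (potential z b y) ∂P t x)
      atTop (𝓝 0)) :
    AsymptoticallyStable P := by
  have hmeas : Measurable fun x => ENNReal.ofReal (potential z b x) := by
    have hcont : Continuous (potential z b) := by unfold potential; fun_prop
    exact hcont.measurable.ennreal_ofReal
  have hdirac : ∀ t, P t z = Measure.dirac z := by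
    intro t
    have hae : ∀ᵐ y ∂P t z, y = z := by
      filter_upwards [(lintegral_eq_zero_iff hmeas).1 (hz t)] with y hy
      have h1 : potential z b y ≤ 0 := ENNReal.ofReal_eq_zero.1 hy
      have h2 : √(dist y z) ≤ 0 := (min_le_iff.1 h1).resolve_right (not_le.2 hb)
      exact dist_le_zero.1 (Real.sqrt_eq_zero'.1 (le_antisymm h2 (Real.sqrt_nonneg _)))
    refine Measure.ext_of_lintegral _ fun f hf => ?_
    rw [lintegral_dirac' z hf, lintegral_congr_ae (g := fun _ => f z)
      (hae.mono fun y hy => by rw [hy])]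
    simp
  have hconv : ∀ ν : Measure X, IsProbabilityMeasure ν → ∀ f : X →ᵇ ℝ,
      Tendsto (fun t : ℝ≥0 => ∫ x, f x ∂(dualSemigroup P t ν)) atTop (𝓝 (f z)) := by
    intro ν hν f
    have hprob : ∀ t, IsProbabilityMeasure (dualSemigroup P t ν) := fun t =>
      isProbabilityMeasure_bind (hP t).aemeasurable (Eventually.of_forall fun x => inferInstance)
    refine tendsto_integral_of_tendsto_lintegral_potential hb ?_ f
    have heq : ∀ t, ∫⁻ x, ENNReal.ofReal (potential z b x) ∂dualSemigroup P t ν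
        = ∫⁻ x, ∫⁻ y, ENNReal.ofReal (potential z b y) ∂P t x ∂ν := fun t =>
      Measure.lintegral_bind (hP t).aemeasurable hmeas.aemeasurable
    simp only [heq]
    have := tendsto_lintegral_filter_of_dominated_convergence (μ := ν) (l := (atTop : Filter ℝ≥0))
      (F := fun t x => ∫⁻ y, ENNReal.ofReal (potential z b y) ∂P t x) (f := fun _ => 0)
      (fun _ => ENNReal.ofReal b)
      (Eventually.of_forall fun t => (Measure.measurable_lintegral hmeas).comp (hP t))
      (Eventually.of_forall fun t => Eventually.of_forall fun x =>
        (lintegral_mono fun y => ENNReal.ofReal_le_ofReal (min_le_right _ _)).trans_eq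
          (by simp))
      (by simp) (Eventually.of_forall hlim)
    simpa using this
  refine ⟨Measure.dirac z, inferInstance, fun t => ?_, fun ν hν hinv => ?_, fun ν hν f => ?_⟩
  · rw [dualSemigroup, Measure.dirac_bind (hP t), hdirac]
  · refine ext_of_forall_integral_eq_of_IsFiniteMeasure fun f => ?_
    have h := hconv ν hν f
    simp only [hinv _] at h
    rw [integral_dirac]
    exact tendsto_nhds_unique tendsto_const_nhds h
  · rw [integral_dirac]
    exact hconv ν hν f

theorem mainTheorem2 {X : Type*} [MetricSpace X] [PolishSpace X] [MeasurableSpace X]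
    [BorelSpace X] {N : ℕ} [NeZero N] (Q : JumpIFS X N) (z : X) (r : X → ℝ) (ω : ℝ → ℝ) (α : ℝ)
    -- the maps and the probabilities are continuous
    (hw : ∀ i, Continuous (Q.w i)) (hp : ∀ i, Continuous (Q.p i))
    -- place-dependent contraction towards `z`
    (hr : Continuous r) (hr_mem : ∀ x, r x ∈ Ioc (0 : ℝ) 1)
    (hcontr : ∀ x, ∑ i, Q.p i x * dist (Q.w i x) z ≤ r x * dist x z)
    -- concave modulus controlling the probabilities
    (hω_concave : ConcaveOn ℝ (Ici 0) ω) (hω_mono : MonotoneOn ω (Ici 0)) (hω_zero : ω 0 = 0)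
    (hω : ∀ x, ∑ i, |Q.p i x - Q.p i z| ≤ ω (dist x z))
    -- exponential Lipschitz bound for the flow
    (hα : 0 ≤ α) (hα_lt : α < Q.lam)
    (hS : ∀ (t : ℝ≥0) (x y : X), dist (Q.S t x) (Q.S t y) ≤ Real.exp (α * t) * dist x y)
    -- the modulus is not degenerate if the flow may expand
    (hω_ne : 0 < α → ∃ s, 0 ≤ s ∧ ω s ≠ 0)
    -- summability
    (hsum : ∃ M : ℕ, ∃ η > (0 : ℝ), ∃ γ ∈ Ioo (0 : ℝ) 1, ∀ x ∈ Metric.ball z η,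
      Summable (fun n : ℕ => ω (Q.maxContraction r (M + n) x * dist x z *
        (Q.lam ^ (M + n) / (Q.lam - α) ^ (M + n)))) ∧
      ∑' n : ℕ, ω (Q.maxContraction r (M + n) x * dist x z *
        (Q.lam ^ (M + n) / (Q.lam - α) ^ (M + n))) ≤ 1 - γ)
    -- `z` is fixed by the flow
    (hz : ∀ t : ℝ≥0, Q.S t z = z)
    -- every neighbourhood of `z` is reached with uniformly positive probability
    (hreach : ∀ ε > (0 : ℝ), ∃ β > (0 : ℝ), ∀ x : X, ∃ t : ℝ≥0,
      β < (Q.semigroup t x).real (Metric.ball z ε)) :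
    AsymptoticallyStable Q.semigroup := by
  have hprob := Q.isProbabilityMeasure_semigroup hw hp
  obtain ⟨u, hu, hloc⟩ := Q.exists_forall_r_le hp hr hr_mem hcontr hω_mono hω_zero hα hα_lt
    hω_ne hsum
  set b : ℝ := √u
  have hb : 0 < b := Real.sqrt_pos.2 hu
  have hbu : b ^ 2 = u := Real.sq_sqrt hu.le
  have hcont : Continuous (potential z b) := by unfold potential; fun_prop
  have hmeas : Measurable fun x => ENNReal.ofReal (potential z b x) :=
    hcont.measurable.ennreal_ofReal
  have hbound : ∀ x, ENNReal.ofReal (potential z b x) ≤ ENNReal.ofReal b := fun x =>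
    ENNReal.ofReal_le_ofReal (min_le_right _ _)
  have hexc : ∀ t x, ∫⁻ y, ENNReal.ofReal (potential z b y) ∂Q.semigroup t x
      ≤ ENNReal.ofReal (potential z b x) := fun t x =>
    Q.le_of_le_renewal_of_renewal_le
      (g := fun t x => ∫⁻ y, ENNReal.ofReal (potential z b y) ∂Q.semigroup t x)
      (h := fun _ x => ENNReal.ofReal (potential z b x)) (B := ENNReal.ofReal b)
      ENNReal.ofReal_ne_top (fun t x => (lintegral_mono hbound).trans_eq (by simp))
      (fun t x => (Q.lintegral_semigroup_eq_renewal hw hp hmeas t x).le)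
      (Q.renewal_potential_le hα hα_lt hcontr hS hz hb (by rwa [hbu])) t x
  have hpotz : potential z b z = 0 := by simp [potential, hb.le]
  have hlim : Tendsto (fun x => ENNReal.ofReal (potential z b x)) (𝓝 z) (𝓝 0) := by
    simpa [hpotz, Function.comp_def] using (ENNReal.continuous_ofReal.comp hcont).tendsto z
  exact asymptoticallyStable_of_tendsto_potential (Q.measurable_semigroup hw hp) hb
    (fun t => le_antisymm ((hexc t z).trans_eq (by simp [hpotz])) zero_le)
    (tendsto_lintegral_zero_of_excessive (Q.measurable_semigroup hw hp) hmeas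
      ENNReal.ofReal_ne_top hbound
      (fun t s x => Q.lintegral_semigroup_add hw hp hmeas ENNReal.ofReal_ne_top hbound t s x)
      hexc (fun δ hδ =>
        Metric.eventually_nhds_iff_ball.1 (ENNReal.tendsto_nhds_zero.1 hlim δ hδ)) hreach)
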